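/- Let $N\in\mathbb N$. Let $\rho:\mathbb R^N\to\mathbb R$ be continuous, positive, bounded and Lebesgue integrable, and let $C_\rho(\mathbb R^N)$ be the space of continuous $u:\mathbb R^N\to\mathbb R$ with $\|u\|_\rho:=\sup_x |u(x)|\rho(x)<\infty$. Let $J:\mathbb R^N\to\mathbb R$ be integrable, nonnegative and even, let $h:\mathbb R^N\to\mathbb R$ be continuous and bounded, and let $f:\mathbb R\to\mathbb R$ be globally Lipschitz, differentiable, bounded and strictly increasing, with $0$ in the closure of the range $f(\mathbb R)$ and with $f^{-1}$ integrable on $f(\mathbb R)$. Write $(J*_\rho v)(x)=\int_{\mathbb R^N}J(x-y)v(y)\rho(y)\,dy$. Then the equation $$\frac{\partial u}{\partial t}=-u+J*_\rho(f\circ u)+h$$ generates a flow $T(t)$, $t\in\mathbb R$, in $C_\rho(\mathbb R^N)$: for every $u_0\in C_\rho(\mathbb R^N)$, $t\mapsto T(t)u_0$ is differentiable in the norm $\|\cdot\|_\rho$ and solves the equation on $\mathbb R$ with value $u_0$ at $t=0$; it is the only solution on any interval containing $0$; $T(s+t)=T(s)T(t)$; and $(t,u_0)\mapsto T(t)u_0$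 is continuous. For every $u\in C_\rho(\mathbb R^N)$ all integrals in $$F(u)=\int_{\mathbb R^N}\Big[-\tfrac12 f(u(x))\int_{\mathbb R^N}J(x-y)f(u(y))\rho(y)\,dy+\int_0^{f(u(x))}f^{-1}(r)\,dr-h(x)f(u(x))\Big]\rho(x)\,dx$$ exist and are finite. The flow is gradient, in the following sense. 1. Every positive orbit $\{T(t)u: t\ge 0\}$ that is bounded is precompact (has compact closure) in $C_\rho(\mathbb R^N)$. 2. $F$ is a continuous Lyapunov functional for $T$: it is continuous on $C_\rho(\mathbb R^N)$ and bounded below, $t\mapsto F(T(t)u)$ is nonincreasing on $[0,\infty)$ for every $u$, and if $F(T(t)u)=F(u)$ for all $t\in\mathbb R$, then $u$ is an equilibrium, that is, $T(t)u=u$ for all $t$. 3. There is also a functional $V:C_\rho(\mathbb R^N)\to\mathbb R$ that has all the properties listed in 2 and satisfies in addition $V(u)\to\infty$ as $\|u\|_\rho\to\infty$ (so that $T$ is a gradient system in Hale's sense, which includes this requirement). -/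

import Mathlib

open MeasureTheory Filter Topology

noncomputable section

namespace NeuralField

/-- A weight on `ℝᴺ`: continuous, positive, bounded and integrable. -/
structure Weight (N : ℕ) where
  toFun : EuclideanSpace ℝ (Fin N) → ℝ
  continuous_toFun : Continuous toFun
  pos : ∀ x, 0 < toFun x
  bounded : ∃ C, ∀ x, toFun x ≤ C
  integrable : Integrable toFun

instance (N : ℕ) : CoeFun (Weight N) (fun _ => EuclideanSpace ℝ (Fin N) → ℝ) := ⟨Weight.toFun⟩

/-- The vector space of continuous `u : ℝᴺ → ℝ` for which `u * ρ` is bounded. -/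
def weightedSubmodule {N : ℕ} (ρ : Weight N) : Submodule ℝ C(EuclideanSpace ℝ (Fin N), ℝ) where
  carrier := {u | ∃ C, ∀ x, |u x| * ρ x ≤ C}
  zero_mem' := ⟨0, fun x => by simp⟩
  add_mem' := by
    rintro u v ⟨C, hC⟩ ⟨D, hD⟩
    refine ⟨C + D, fun x => ?_⟩
    have h1 := mul_le_mul_of_nonneg_right (abs_add_le (u x) (v x)) (ρ.pos x).le
    have h2 := hC x
    have h3 := hD x
    simp only [ContinuousMap.add_apply]
    linarith [add_mul |u x| |v x| (ρ x)]
  smul_mem' := by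
    rintro c u ⟨C, hC⟩
    refine ⟨|c| * C, fun x => ?_⟩
    have h1 := mul_le_mul_of_nonneg_left (hC x) (abs_nonneg c)
    simpa [abs_mul, mul_assoc] using h1

/-- The phase space `C_ρ(ℝᴺ)`. It is a new type, so that its topology is the one of the weighted
norm and not the compact-open topology of `C(ℝᴺ, ℝ)`. -/
def CRho {N : ℕ} (ρ : Weight N) : Type := weightedSubmodule ρ

namespace CRho

variable {N : ℕ} {ρ : Weight N}

instance : AddCommGroup (CRho ρ) := inferInstanceAs (AddCommGroup (weightedSubmodule ρ))

instance : Module ℝ (CRho ρ) := inferInstanceAs (Module ℝ (weightedSubmodule ρ))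

instance : CoeFun (CRho ρ) (fun _ => EuclideanSpace ℝ (Fin N) → ℝ) := ⟨fun u x => u.1 x⟩

/-- The linear map `u ↦ u * ρ` into the bounded continuous functions; the norm of `C_ρ(ℝᴺ)` is
induced by it. -/
def mulWeight (ρ : Weight N) :
    CRho ρ →ₗ[ℝ] BoundedContinuousFunction (EuclideanSpace ℝ (Fin N)) ℝ where
  toFun u := BoundedContinuousFunction.ofNormedAddCommGroup (fun x => u x * ρ x)
    (u.1.continuous.mul ρ.continuous_toFun) u.2.choose (fun x => by
      have h := u.2.choose_spec x
      rwa [Real.norm_eq_abs, abs_mul, abs_of_pos (ρ.pos x)])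
  map_add' u v := by
    ext x
    exact add_mul (u x) (v x) (ρ x)
  map_smul' c u := by
    ext x
    exact mul_assoc c (u x) (ρ x)

theorem mulWeight_apply (u : CRho ρ) (x : EuclideanSpace ℝ (Fin N)) :
    mulWeight ρ u x = u x * ρ x := rfl

theorem mulWeight_injective : Function.Injective (mulWeight ρ) := by
  intro u v huv
  apply Subtype.ext
  ext x
  have h : u x * ρ x = v x * ρ x := by
    rw [← mulWeight_apply, ← mulWeight_apply, huv]
  exact mul_right_cancel₀ (ρ.pos x).ne' h

instance : NormedAddCommGroup (CRho ρ) :=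
  NormedAddCommGroup.induced (CRho ρ) _ (mulWeight ρ) mulWeight_injective

instance : NormedSpace ℝ (CRho ρ) := NormedSpace.induced ℝ (CRho ρ) _ (mulWeight ρ)

/-- The norm of `C_ρ(ℝᴺ)` is `sup_x |u x| ρ x`. -/
theorem norm_eq_iSup (u : CRho ρ) : ‖u‖ = ⨆ x, |u x| * ρ x := by
  have h : ‖u‖ = ‖mulWeight ρ u‖ := rfl
  rw [h, BoundedContinuousFunction.norm_eq_iSup_norm]
  refine congrArg iSup (funext fun x => ?_)
  rw [mulWeight_apply, Real.norm_eq_abs, abs_mul, abs_of_pos (ρ.pos x)]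

end CRho

/-- Convolution with respect to the measure `ρ(y) dy`. -/
def wconv {N : ℕ} (ρ : Weight N) (J v : EuclideanSpace ℝ (Fin N) → ℝ)
    (x : EuclideanSpace ℝ (Fin N)) : ℝ :=
  ∫ y, J (x - y) * v y * ρ y

/-- `u` is a solution on `I` of `u' = -u + J *_ρ (f ∘ u) + h`, the derivative being taken in the
norm of `C_ρ(ℝᴺ)`. -/
def IsSolutionOn {N : ℕ} {ρ : Weight N} (J h : EuclideanSpace ℝ (Fin N) → ℝ) (f : ℝ → ℝ)
    (u : ℝ → CRho ρ) (I : Set ℝ) : Prop :=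
  ∀ t ∈ I, ∃ v : CRho ρ, HasDerivWithinAt u v I t ∧
    ∀ x, v x = -(u t x) + wconv ρ J (fun y => f (u t y)) x + h x

/-- `T` is the flow generated by the equation in `C_ρ(ℝᴺ)`: every initial datum has a globally
defined solution `t ↦ T t u`, unique among the solutions on all intervals containing `0`, which
depends continuously on time and on the initial datum. -/
structure IsGeneratedFlow {N : ℕ} {ρ : Weight N} (J h : EuclideanSpace ℝ (Fin N) → ℝ)
    (f : ℝ → ℝ) (T : ℝ → CRho ρ → CRho ρ) : Prop where
  map_zero : ∀ u, T 0 u = u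
  map_add : ∀ s t u, T (s + t) u = T s (T t u)
  isSolution : ∀ u, IsSolutionOn J h f (fun t => T t u) Set.univ
  unique : ∀ (I : Set ℝ) (v : ℝ → CRho ρ), I.OrdConnected → 0 ∈ I →
    IsSolutionOn J h f v I → ∀ t ∈ I, v t = T t (v 0)
  continuous : Continuous (fun p : ℝ × CRho ρ => T p.1 p.2)

/-- `V` is a continuous Lyapunov functional for the flow `T`: continuous, bounded below,
nonincreasing along positive orbits, and constant along a complete orbit only if this orbit is an
equilibrium. -/
structure IsLyapunovFunctional {X : Type*} [NormedAddCommGroup X] (T : ℝ → X → X)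
    (V : X → ℝ) : Prop where
  continuous : Continuous V
  bddBelow : BddBelow (Set.range V)
  nonincreasing : ∀ u, AntitoneOn (fun t => V (T t u)) (Set.Ici 0)
  equilibrium : ∀ u, (∀ t, V (T t u) = V u) → ∀ t, T t u = u

/-- Bounded positive orbits are precompact. -/
def BoundedOrbitsPrecompact {X : Type*} [NormedAddCommGroup X] (T : ℝ → X → X) : Prop :=
  ∀ u, Bornology.IsBounded ((fun t => T t u) '' Set.Ici 0) →
    IsCompact (closure ((fun t => T t u) '' Set.Ici 0))

/-- Gradient systems in the sense of Hale. -/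
structure IsGradient {X : Type*} [NormedAddCommGroup X] (T : ℝ → X → X) : Prop where
  precompact : BoundedOrbitsPrecompact T
  lyapunov : ∃ V : X → ℝ, IsLyapunovFunctional T V ∧ Tendsto V (Bornology.cobounded X) atTop

/-- The integrand, with respect to `ρ(x) dx`, of the energy functional. -/
def energyDensity {N : ℕ} {ρ : Weight N} (J h : EuclideanSpace ℝ (Fin N) → ℝ) (f : ℝ → ℝ)
    (u : CRho ρ) (x : EuclideanSpace ℝ (Fin N)) : ℝ :=
  -(1 / 2) * f (u x) * wconv ρ J (fun y => f (u y)) x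
    + (∫ r in (0 : ℝ)..f (u x), Function.invFun f r) - h x * f (u x)

/-- The energy functional `F`. -/
def energy {N : ℕ} {ρ : Weight N} (J h : EuclideanSpace ℝ (Fin N) → ℝ) (f : ℝ → ℝ)
    (u : CRho ρ) : ℝ :=
  ∫ x, energyDensity J h f u x * ρ x

end NeuralField

end

noncomputable section

namespace NeuralField

/-! ### Relaxation equations `u' = -u + B u` in a Banach space. -/

section AbstractFlow

open Set

/-! The equation is `u' = -u + B u`, where the input `B u = J *_ρ (f ∘ u) + h` is bounded and
Lipschitz on the Banach space `C_ρ`, so Picard–Lindelöf yields a global flow. The range of `B` is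
totally bounded, because the convolutions are equicontinuous and vanish uniformly at infinity
(`totallyBounded_range_synaptic`). At time `t ≥ 0` a solution is a convex combination, with weights
`e^{-t}` and `1 - e^{-t}`, of its initial value and a point of the closed convex hull of this range
(`exists_mem_eq_exp_smul_add`). The hull is compact, hence positive orbits are precompact.

Formally `dF/dt = -∫ f'(u) |u_t|² ρ`, since `J` is even. As `u` and `f⁻¹` may be unbounded, the
energy is not differentiated but compared over a time step `δ ≤ 1`. Convexity of the primitive of
`f⁻¹` and symmetry of the quadratic form give `ΔF + (c/δ) ∫ (Δf(u))² ρ ≤ C δ³`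
(`exists_energy_step_le`). Adding up ever shorter steps shows that `F` is nonincreasing. If `F` is
constant, the same estimate makes `∫ |Δf(u)| ρ` of order `δ²`; adding up again, `f ∘ u` does not
move, and `u` does not either because `f` is injective. Both summations are
`antitoneOn_of_sub_le_sq`.

`F` is bounded and so cannot be coercive. If `M` bounds the input, `max (‖u‖ - M) 0` is
nonincreasing along positive orbits, and adding it to `F` gives the functional required by Hale's
definition. -/

theorem lipschitzWith_neg_add {E : Type*} [NormedAddCommGroup E] {B : E → E} {K : NNReal}
    (hB : LipschitzWith K B) : LipschitzWith (1 + K) (fun u => -u + B u) :=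
  LipschitzWith.id.neg.add hB

variable {E : Type*} [NormedAddCommGroup E] [NormedSpace ℝ E]

/-- Two solutions of an autonomous Lipschitz equation on an interval containing `0` agree if they
agree at `0`. -/
theorem eqOn_of_hasDerivWithinAt_lipschitz {X : E → E} {K : NNReal} (hX : LipschitzWith K X)
    {I : Set ℝ} (hI : I.OrdConnected) (h0 : 0 ∈ I) {v w : ℝ → E}
    (hv : ∀ t ∈ I, HasDerivWithinAt v (X (v t)) I t)
    (hw : ∀ t ∈ I, HasDerivWithinAt w (X (w t)) I t) (h : v 0 = w 0) : EqOn v w I := by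
  intro t ht
  rcases le_total 0 t with h0t | ht0
  · have hsub : Icc 0 t ⊆ I := hI.out h0 ht
    have key : ∀ z : ℝ → E, (∀ s ∈ I, HasDerivWithinAt z (X (z s)) I s) →
        ∀ s ∈ Ico 0 t, HasDerivWithinAt z (X (z s)) (Ici s) s := fun z hz s hs =>
      (hz s (hsub ⟨hs.1, hs.2.le⟩)).mono_of_mem_nhdsWithin
        (mem_of_superset (Icc_mem_nhdsGE hs.2) ((Icc_subset_Icc_left hs.1).trans hsub))
    exact ODE_solution_unique (v := fun _ => X) (fun _ => hX)
      (fun s hs => ((hv s (hsub hs)).continuousWithinAt).mono hsub) (key v hv)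
      (fun s hs => ((hw s (hsub hs)).continuousWithinAt).mono hsub) (key w hw) h ⟨h0t, le_rfl⟩
  · have hsub : Icc t 0 ⊆ I := hI.out ht h0
    have key : ∀ z : ℝ → E, (∀ s ∈ I, HasDerivWithinAt z (X (z s)) I s) →
        ∀ s ∈ Ioc t 0, HasDerivWithinAt z (X (z s)) (Iic s) s := fun z hz s hs =>
      (hz s (hsub ⟨hs.1.le, hs.2⟩)).mono_of_mem_nhdsWithin
        (mem_of_superset (Icc_mem_nhdsLE hs.1) ((Icc_subset_Icc_right hs.2).trans hsub))
    exact ODE_solution_unique_of_mem_Icc_left (v := fun _ => X) (s := fun _ => univ)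
      (fun _ _ => hX.lipschitzOnWith)
      (fun s hs => ((hv s (hsub hs)).continuousWithinAt).mono hsub) (key v hv) (fun _ _ => trivial)
      (fun s hs => ((hw s (hsub hs)).continuousWithinAt).mono hsub) (key w hw) (fun _ _ => trivial)
      h ⟨le_rfl, ht0⟩

/-- Solutions of an autonomous Lipschitz equation depend continuously on the initial datum. -/
theorem dist_le_of_hasDerivAt_lipschitz {X : E → E} {K : NNReal} (hX : LipschitzWith K X)
    {v w : ℝ → E} (hv : ∀ t, HasDerivAt v (X (v t)) t) (hw : ∀ t, HasDerivAt w (X (w t)) t)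
    (t : ℝ) : dist (v t) (w t) ≤ dist (v 0) (w 0) * Real.exp (K * |t|) := by
  have forward : ∀ {Y : E → E}, LipschitzWith K Y → ∀ {v w : ℝ → E},
      (∀ t, HasDerivAt v (Y (v t)) t) → (∀ t, HasDerivAt w (Y (w t)) t) → ∀ t, 0 ≤ t →
      dist (v t) (w t) ≤ dist (v 0) (w 0) * Real.exp (K * t) := by
    intro Y hY v w hv hw t ht
    have := dist_le_of_trajectories_ODE (v := fun _ => Y) (a := 0) (b := t) (fun _ => hY)
      (fun s _ => (hv s).continuousAt.continuousWithinAt) (fun s _ => (hv s).hasDerivWithinAt)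
      (fun s _ => (hw s).continuousAt.continuousWithinAt) (fun s _ => (hw s).hasDerivWithinAt)
      le_rfl t ⟨ht, le_rfl⟩
    simpa using this
  rcases le_total 0 t with ht | ht
  · rw [abs_of_nonneg ht]
    exact forward hX hv hw t ht
  · have hneg : ∀ {z : ℝ → E}, (∀ t, HasDerivAt z (X (z t)) t) →
        ∀ t, HasDerivAt (fun s => z (-s)) ((fun x => -X x) (z (-t))) t := by
      intro z hz t
      simpa [Function.comp_def] using (hz (-t)).scomp t (hasDerivAt_neg t)
    have := forward (Y := fun x => -X x) hX.neg (hneg hv) (hneg hw) (-t) (by linarith)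
    simpa [abs_of_nonpos ht] using this

section Relaxation

variable {B : E → E} {K : NNReal} {M : ℝ}

/-- `u' = -u + B u` has solutions on `[-n, n]` when `B` is bounded and Lipschitz. -/
theorem exists_relaxation_solution_Icc [CompleteSpace E] (hB : LipschitzWith K B)
    (hM : ∀ u, ‖B u‖ ≤ M) (u₀ : E) (n : ℕ) :
    ∃ α : ℝ → E, α 0 = u₀ ∧ ∀ t ∈ Icc (-n : ℝ) n,
      HasDerivWithinAt α (-α t + B (α t)) (Icc (-n : ℝ) n) t := by
  have hM0 : 0 ≤ M := (norm_nonneg _).trans (hM u₀)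
  have hn : (0 : ℝ) ≤ n := n.cast_nonneg
  -- Variation of constants: `w = e^t α` satisfies `w' = e^t B(e^{-t} w)`, which is bounded by `L`
  -- on `[-n, n]`. A ball of radius `L * n` then suffices for the whole interval, and the two
  -- exponentials cancel in the Lipschitz constant.
  let L : NNReal := ⟨Real.exp n * M, by positivity⟩
  have hP : IsPicardLindelof (fun t w => Real.exp t • B (Real.exp (-t) • w))
      (tmin := -n) (tmax := n) ⟨0, by simp⟩ u₀ (L * n) 0 L K := by
    refine ⟨fun t _ => LipschitzWith.lipschitzOnWith ?_, fun x _ => ?_, fun t ht x _ => ?_, ?_⟩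
    · refine LipschitzWith.of_dist_le_mul fun x y => ?_
      rw [dist_smul₀, Real.norm_eq_abs, Real.abs_exp]
      calc Real.exp t * dist (B (Real.exp (-t) • x)) (B (Real.exp (-t) • y))
          ≤ Real.exp t * (K * dist (Real.exp (-t) • x) (Real.exp (-t) • y)) := by
            gcongr; exact hB.dist_le_mul _ _
        _ = K * dist x y * (Real.exp t * Real.exp (-t)) := by
            rw [dist_smul₀, Real.norm_eq_abs, Real.abs_exp]; ring
        _ = K * dist x y := by rw [← Real.exp_add]; simp
    · have := hB.continuous
      fun_prop
    · rw [norm_smul, Real.norm_eq_abs, Real.abs_exp]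
      change _ ≤ Real.exp n * M
      gcongr
      · exact ht.2
      · exact hM _
    · simp
  obtain ⟨w, hw0, hw⟩ := hP.exists_eq_forall_mem_Icc_hasDerivWithinAt₀
  refine ⟨fun t => Real.exp (-t) • w t, by simpa using hw0, fun t ht => ?_⟩
  have h1 : HasDerivWithinAt (fun t : ℝ => Real.exp (-t)) (-Real.exp (-t)) (Icc (-n : ℝ) n) t := by
    simpa using ((hasDerivAt_neg t).exp).hasDerivWithinAt
  have h2 := h1.fun_smul (hw t ht)
  rw [smul_smul, ← Real.exp_add] at h2
  simpa [add_comm] using h2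

/-- `u' = -u + B u` has global solutions when `B` is bounded and Lipschitz. -/
theorem exists_relaxation_solution [CompleteSpace E] (hB : LipschitzWith K B)
    (hM : ∀ u, ‖B u‖ ≤ M) (u₀ : E) :
    ∃ α : ℝ → E, α 0 = u₀ ∧ ∀ t, HasDerivAt α (-α t + B (α t)) t := by
  choose α hα0 hα using exists_relaxation_solution_Icc hB hM u₀
  have agree : ∀ m n : ℕ, m ≤ n → EqOn (α m) (α n) (Icc (-m : ℝ) m) := by
    intro m n hmn
    have hmn' : (m : ℝ) ≤ n := by exact_mod_cast hmn
    have hsub : Icc (-m : ℝ) m ⊆ Icc (-n : ℝ) n := Icc_subset_Icc (by linarith) hmn'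
    exact eqOn_of_hasDerivWithinAt_lipschitz (lipschitzWith_neg_add hB) ordConnected_Icc (by simp)
      (hα m) (fun t ht => (hα n t (hsub ht)).mono hsub) ((hα0 m).trans (hα0 n).symm)
  have mem : ∀ t : ℝ, t ∈ Icc (-⌈|t|⌉₊ : ℝ) ⌈|t|⌉₊ := fun t => abs_le.1 (Nat.le_ceil _)
  have eq : ∀ (n : ℕ) (t : ℝ), |t| ≤ n → α ⌈|t|⌉₊ t = α n t := fun n t ht =>
    agree _ _ (Nat.ceil_le.2 ht) (mem t)
  refine ⟨fun t => α ⌈|t|⌉₊ t, by simp [hα0], fun t => ?_⟩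
  -- The extra 1 puts `t` in the interior of `[-n, n]`, where the derivative within the interval is
  -- a derivative.
  set n := ⌈|t|⌉₊ + 1 with hn
  have ht : |t| < n := by
    have := Nat.le_ceil |t|
    push_cast [hn]
    linarith
  have hev : (fun t => α ⌈|t|⌉₊ t) =ᶠ[𝓝 t] α n := by
    filter_upwards [(continuous_abs.tendsto t).eventually (gt_mem_nhds ht)] with s hs
    exact eq n s hs.le
  have h1 := (hα n t (abs_le.1 ht.le)).hasDerivAt
    (Icc_mem_nhds (abs_lt.1 ht).1 (abs_lt.1 ht).2)
  beta_reduce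
  rw [eq n t ht.le]
  exact h1.congr_of_eventuallyEq hev

/-- A solution of `u' = -u + B u` moves on segments towards any closed convex set containing the
range of `B`. -/
theorem exists_mem_eq_exp_smul_add {α : ℝ → E} (hα : ∀ t, HasDerivAt α (-α t + B (α t)) t)
    {C : Set E} (hC : Convex ℝ C) (hCc : IsClosed C) (hBC : ∀ u, B u ∈ C) {t : ℝ} (ht : 0 ≤ t) :
    ∃ k ∈ C, α t = Real.exp (-t) • α 0 + (1 - Real.exp (-t)) • k := by
  rcases ht.eq_or_lt with rfl | ht
  · exact ⟨B (α 0), hBC _, by simp⟩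
  have hpos : 0 < 1 - Real.exp (-t) := by
    have := Real.exp_lt_one_iff.2 (show -t < 0 by linarith)
    linarith
  set k := (1 - Real.exp (-t))⁻¹ • (α t - Real.exp (-t) • α 0) with hk
  have hkt : α t = Real.exp (-t) • α 0 + (1 - Real.exp (-t)) • k := by
    rw [hk, smul_smul, mul_inv_cancel₀ hpos.ne']
    simp
  refine ⟨k, ?_, hkt⟩
  -- A functional `l` that is below `s` on `C` and above `s` at `k` is contradictory: `e^τ (l (α τ)
  -- - s)` is nonincreasing, yet between `0` and `t` it grows by `(e^t - 1)(l k - s) > 0`.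
  by_contra hkC
  obtain ⟨l, s, hls, hsk⟩ := geometric_hahn_banach_closed_point hC hCc hkC
  have hder : ∀ τ, HasDerivAt (fun τ => Real.exp τ * (l (α τ) - s))
      (Real.exp τ * (l (B (α τ)) - s)) τ := by
    intro τ
    have h1 := (Real.hasDerivAt_exp τ).mul ((l.hasFDerivAt.comp_hasDerivAt τ (hα τ)).sub_const s)
    refine h1.congr_deriv ?_
    simp only [Function.comp_apply, map_add, map_neg]
    ring
  have hanti : Antitone (fun τ => Real.exp τ * (l (α τ) - s)) :=
    antitone_of_hasDerivAt_nonpos hder fun τ =>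
      mul_nonpos_of_nonneg_of_nonpos (Real.exp_pos τ).le (by linarith [hls _ (hBC (α τ))])
  have h1 : Real.exp t * (l (α t) - s) ≤ l (α 0) - s := by simpa using hanti ht.le
  have h2 : l (α t) = Real.exp (-t) * l (α 0) + (1 - Real.exp (-t)) * l k := by
    conv_lhs => rw [hkt]
    simp
  have h3 : Real.exp t * Real.exp (-t) = 1 := by rw [← Real.exp_add]; simp
  have h4 : Real.exp t * (l (α t) - s) - (l (α 0) - s) = (Real.exp t - 1) * (l k - s) := by
    rw [h2]
    linear_combination (l (α 0) - l k) * h3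
  have h5 : 1 < Real.exp t := Real.one_lt_exp_iff.2 ht
  nlinarith

theorem norm_relaxation_le {α : ℝ → E} (hα : ∀ t, HasDerivAt α (-α t + B (α t)) t)
    (hM : ∀ u, ‖B u‖ ≤ M) {t : ℝ} (ht : 0 ≤ t) :
    ‖α t‖ ≤ Real.exp (-t) * ‖α 0‖ + (1 - Real.exp (-t)) * M := by
  obtain ⟨k, hk, h⟩ := exists_mem_eq_exp_smul_add hα (convex_closedBall (0 : E) M)
    Metric.isClosed_closedBall (fun u => by simpa using hM u) ht
  have hk' : ‖k‖ ≤ M := by simpa using hk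
  have h1 : 0 ≤ 1 - Real.exp (-t) := by
    have := Real.exp_le_one_iff.2 (show -t ≤ 0 by linarith)
    linarith
  rw [h]
  refine (norm_add_le _ _).trans ?_
  rw [norm_smul, norm_smul, Real.norm_eq_abs, Real.norm_eq_abs, Real.abs_exp, abs_of_nonneg h1]
  gcongr

/-- Positive orbits of `u' = -u + B u` are precompact when the range of `B` is. -/
theorem isCompact_closure_relaxation_orbit [CompleteSpace E] {α : ℝ → E}
    (hα : ∀ t, HasDerivAt α (-α t + B (α t)) t) (hB : TotallyBounded (range B)) :
    IsCompact (closure (α '' Ici 0)) := by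
  set C := closure (convexHull ℝ (range B)) with hCdef
  have hC : IsCompact C := hB.convexHull.closure.isCompact_of_isClosed isClosed_closure
  have hcomp : IsCompact ((fun p : ℝ × E => p.1 • α 0 + (1 - p.1) • p.2) '' (Icc 0 1 ×ˢ C)) :=
    (isCompact_Icc.prod hC).image (by fun_prop)
  refine hcomp.closure_of_subset ?_
  rintro _ ⟨t, ht, rfl⟩
  obtain ⟨k, hk, h⟩ := exists_mem_eq_exp_smul_add hα (convex_convexHull ℝ (range B)).closure
    isClosed_closure (fun u => subset_closure (subset_convexHull ℝ _ ⟨u, rfl⟩)) ht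
  exact ⟨(Real.exp (-t), k), ⟨⟨(Real.exp_pos _).le, Real.exp_le_one_iff.2 (by simpa using ht)⟩, hk⟩,
    h.symm⟩

/-- The equation `u' = -u + B u` with a bounded Lipschitz map `B` generates a flow. -/
theorem exists_relaxation_flow [CompleteSpace E] (hB : LipschitzWith K B)
    (hM : ∀ u, ‖B u‖ ≤ M) :
    ∃ T : ℝ → E → E, (∀ u, T 0 u = u) ∧ (∀ u t, HasDerivAt (fun t => T t u) (-T t u + B (T t u)) t) ∧
      (∀ s t u, T (s + t) u = T s (T t u)) ∧
      (∀ (I : Set ℝ) (v : ℝ → E), I.OrdConnected → 0 ∈ I →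
        (∀ t ∈ I, HasDerivWithinAt v (-v t + B (v t)) I t) → ∀ t ∈ I, v t = T t (v 0)) ∧
      Continuous (fun p : ℝ × E => T p.1 p.2) := by
  have hX := lipschitzWith_neg_add hB
  choose α hα0 hα using exists_relaxation_solution hB hM
  have huniq : ∀ (I : Set ℝ) (v : ℝ → E), I.OrdConnected → 0 ∈ I →
      (∀ t ∈ I, HasDerivWithinAt v (-v t + B (v t)) I t) → ∀ t ∈ I, v t = α (v 0) t :=
    fun I v hI h0 hv => eqOn_of_hasDerivWithinAt_lipschitz hX hI h0 hv
      (fun t _ => (hα _ t).hasDerivWithinAt) (hα0 _).symm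
  refine ⟨fun t u => α u t, hα0, hα, fun s t u => ?_, huniq, ?_⟩
  · have := huniq univ (fun s => α u (s + t)) ordConnected_univ trivial
      (fun s _ => ((hα u (s + t)).comp_add_const s t).hasDerivWithinAt) s trivial
    simpa using this
  · rw [continuous_iff_continuousAt]
    rintro ⟨t₀, u₀⟩
    rw [ContinuousAt, tendsto_iff_dist_tendsto_zero]
    have hcont : Continuous (fun p : ℝ × E =>
        dist p.2 u₀ * Real.exp ((1 + K : NNReal) * |p.1|) + dist (α u₀ p.1) (α u₀ t₀)) := by
      have : Continuous (α u₀) := continuous_iff_continuousAt.2 fun t => (hα u₀ t).continuousAt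
      fun_prop
    have hlim := hcont.tendsto (t₀, u₀)
    simp only [dist_self, zero_mul, add_zero] at hlim
    refine squeeze_zero (fun _ => dist_nonneg) (fun p => ?_) hlim
    refine (dist_triangle _ (α u₀ p.1) _).trans ?_
    gcongr
    simpa [hα0] using dist_le_of_hasDerivAt_lipschitz hX (hα p.2) (hα u₀) p.1

end Relaxation

end AbstractFlow

/-! ### The Banach space `C_ρ` and compactness in it. -/

namespace Weight

variable {N : ℕ} (ρ : Weight N)

theorem exists_pos_bound : ∃ R, 0 < R ∧ ∀ x, ρ x ≤ R := by
  obtain ⟨R, hR⟩ := ρ.bounded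
  exact ⟨R, (ρ.pos 0).trans_le (hR 0), hR⟩

end Weight

namespace CRho

variable {N : ℕ} {ρ : Weight N}

theorem coe_continuous (u : CRho ρ) : Continuous (fun x => u x) := u.1.continuous

theorem ext {u v : CRho ρ} (h : ∀ x, u x = v x) : u = v :=
  Subtype.ext (ContinuousMap.ext h)

theorem add_apply (u v : CRho ρ) (x : EuclideanSpace ℝ (Fin N)) : (u + v) x = u x + v x := rfl

theorem neg_apply (u : CRho ρ) (x : EuclideanSpace ℝ (Fin N)) : (-u) x = -u x := rfl

theorem sub_apply (u v : CRho ρ) (x : EuclideanSpace ℝ (Fin N)) : (u - v) x = u x - v x := rfl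

theorem abs_mul_le_norm (u : CRho ρ) (x : EuclideanSpace ℝ (Fin N)) : |u x| * ρ x ≤ ‖u‖ := by
  have h := (mulWeight ρ u).norm_coe_le_norm x
  rwa [mulWeight_apply, Real.norm_eq_abs, abs_mul, abs_of_pos (ρ.pos x)] at h

theorem norm_le_of_abs_mul_le {u : CRho ρ} {C : ℝ} (hC : 0 ≤ C) (h : ∀ x, |u x| * ρ x ≤ C) :
    ‖u‖ ≤ C := by
  refine ((mulWeight ρ u).norm_le hC).2 fun x => ?_
  rw [mulWeight_apply, Real.norm_eq_abs, abs_mul, abs_of_pos (ρ.pos x)]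
  exact h x

theorem isometry_mulWeight : Isometry (mulWeight ρ) :=
  AddMonoidHomClass.isometry_of_norm _ fun _ => rfl

theorem mulWeight_surjective : Function.Surjective (mulWeight ρ) := by
  intro g
  have hmul : ∀ x, g x / ρ x * ρ x = g x := fun x => div_mul_cancel₀ _ (ρ.pos x).ne'
  refine ⟨⟨⟨fun x => g x / ρ x, g.continuous.div ρ.continuous_toFun fun x => (ρ.pos x).ne'⟩,
    ‖g‖, fun x => ?_⟩, ?_⟩
  · have h : |g x / ρ x| * ρ x = |g x / ρ x * ρ x| := by rw [abs_mul, abs_of_pos (ρ.pos x)]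
    simp only [ContinuousMap.coe_mk]
    rw [h, hmul]
    exact g.norm_coe_le_norm x
  · ext x
    exact hmul x

instance : CompleteSpace (CRho ρ) :=
  (isometry_mulWeight.isUniformInducing.completeSpace_congr mulWeight_surjective).2 inferInstance

/-- Evaluation at a point, as a continuous linear functional. -/
def eval (x : EuclideanSpace ℝ (Fin N)) : CRho ρ →L[ℝ] ℝ :=
  LinearMap.mkContinuous
    { toFun := fun u => u x
      map_add' := fun _ _ => rfl
      map_smul' := fun _ _ => rfl } (ρ x)⁻¹ fun u => by
    rw [inv_mul_eq_div, le_div_iff₀ (ρ.pos x)]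
    exact abs_mul_le_norm u x

/-- A bounded continuous function as an element of `C_ρ`. -/
def ofBounded (ρ : Weight N) (g : EuclideanSpace ℝ (Fin N) → ℝ) (hg : Continuous g)
    (hb : ∃ C, ∀ x, |g x| ≤ C) : CRho ρ :=
  ⟨⟨g, hg⟩, by
    obtain ⟨C, hC⟩ := hb
    obtain ⟨R, hR, hρ⟩ := ρ.exists_pos_bound
    exact ⟨C * R, fun x => mul_le_mul (hC x) (hρ x) (ρ.pos x).le ((abs_nonneg _).trans (hC x))⟩⟩

theorem norm_le_of_abs_le {u : CRho ρ} {C R : ℝ} (hR : ∀ x, ρ x ≤ R) (h : ∀ x, |u x| ≤ C) :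
    ‖u‖ ≤ C * R := by
  have hC : 0 ≤ C := (abs_nonneg _).trans (h 0)
  exact norm_le_of_abs_mul_le (mul_nonneg hC ((ρ.pos 0).le.trans (hR 0))) fun x =>
    mul_le_mul (h x) (hR x) (ρ.pos x).le hC

/-- An Arzelà–Ascoli criterion: bounded, equicontinuous families of functions that vanish
uniformly at infinity are totally bounded in `C_ρ`. -/
theorem totallyBounded_of_equicontinuous {A : Set (CRho ρ)} {M : ℝ}
    (hM : ∀ u ∈ A, ∀ x, |u x| ≤ M)
    (heq : ∀ x, ∀ ε > 0, ∀ᶠ x' in 𝓝 x, ∀ u ∈ A, |u x' - u x| < ε)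
    (hinf : ∀ ε > 0, ∃ r : ℝ, ∀ u ∈ A, ∀ x, r < ‖x‖ → |u x| ≤ ε) : TotallyBounded A := by
  obtain ⟨R, hR, hρ⟩ := ρ.exists_pos_bound
  refine Metric.totallyBounded_of_finite_discretization fun ε hε => ?_
  -- Functions with the same label differ by at most `2η` on the ball, by the covering, and also
  -- outside it, where each is at most `η`. Their weighted distance is thus at most `2ηR = ε / 2`.
  set η := ε / (4 * R) with hη
  have hηpos : 0 < η := by positivity
  obtain ⟨r, hr⟩ := hinf η hηpos
  let K := Metric.closedBall (0 : EuclideanSpace ℝ (Fin N)) r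
  have : CompactSpace K := isCompact_iff_compactSpace.1 (isCompact_closedBall _ _)
  let res : CRho ρ → BoundedContinuousFunction K ℝ := fun u =>
    BoundedContinuousFunction.mkOfCompact (u.1.restrict K)
  have hres : ∀ u (x : K), res u x = u x := fun _ _ => rfl
  have hcomp : IsCompact (closure (res '' A)) := by
    refine BoundedContinuousFunction.arzela_ascoli (Set.Icc (-M) M) isCompact_Icc _ ?_ ?_
    · rintro _ x ⟨u, hu, rfl⟩
      rw [hres]
      exact abs_le.1 (hM u hu x)
    · intro x
      rw [Metric.equicontinuousAt_iff_right]
      intro δ hδ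
      filter_upwards [(continuous_subtype_val.tendsto x).eventually (heq x δ hδ)] with x' hx'
      rintro ⟨_, u, hu, rfl⟩
      simpa [hres, dist_comm (u.1 x), Real.dist_eq] using hx' u hu
  obtain ⟨t, ht, hcover⟩ :=
    Metric.totallyBounded_iff.1 (hcomp.totallyBounded.subset subset_closure) η hηpos
  have hex : ∀ u : A, ∃ y : t, dist (res u) y < η := fun u => by
    obtain ⟨y, hy, huy⟩ := Set.mem_iUnion₂.1 (hcover ⟨u, u.2, rfl⟩)
    exact ⟨⟨y, hy⟩, huy⟩
  choose F hF using hex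
  refine ⟨t, ht.fintype, F, fun u v huv => ?_⟩
  have hdist : dist (res u) (res v) ≤ 2 * η := by
    have h1 := hF u
    have h2 := hF v
    rw [huv] at h1
    linarith [dist_triangle_right (res u) (res v) (F v)]
  have hpt : ∀ x, |(u.1 - v.1) x| ≤ 2 * η := by
    intro x
    rw [sub_apply]
    by_cases hx : x ∈ K
    · exact ((res u).dist_coe_le_dist (g := res v) ⟨x, hx⟩).trans hdist
    · have hx' : r < ‖x‖ := by simpa [K] using hx
      linarith [abs_sub (u.1 x) (v.1 x), hr u u.2 x hx', hr v v.2 x hx']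
  rw [dist_eq_norm]
  calc ‖u.1 - v.1‖ ≤ 2 * η * R := norm_le_of_abs_le hρ hpt
    _ = ε / 2 := by rw [hη]; field_simp; norm_num
    _ < ε := by linarith

end CRho

/-! ### Weighted convolutions: continuity, compactness and symmetry. -/

section Convolution

variable {N : ℕ} {ρ : Weight N} {J v w : EuclideanSpace ℝ (Fin N) → ℝ}

theorem wconv_eq (ρ : Weight N) (J v : EuclideanSpace ℝ (Fin N) → ℝ)
    (x : EuclideanSpace ℝ (Fin N)) : wconv ρ J v x = ∫ y, J (x - y) * (v y * ρ y) := by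
  simp only [wconv, mul_assoc]

theorem integrable_sub_mul (hJ : Integrable J) (hv : Continuous v) {C : ℝ}
    (hC : ∀ y, |v y * ρ y| ≤ C) (x : EuclideanSpace ℝ (Fin N)) :
    Integrable (fun y => J (x - y) * (v y * ρ y)) :=
  (hJ.comp_sub_left x).mul_bdd (hv.mul ρ.continuous_toFun).aestronglyMeasurable
    (ae_of_all _ hC)

theorem abs_wconv_le (hJ : Integrable J) {C : ℝ} (hC : ∀ y, |v y * ρ y| ≤ C)
    (x : EuclideanSpace ℝ (Fin N)) : |wconv ρ J v x| ≤ C * ∫ z, |J z| := by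
  rw [wconv_eq, ← integral_sub_left_eq_self (fun z => |J z|) volume x, ← integral_const_mul]
  refine (Real.norm_eq_abs _).symm.trans_le (norm_integral_le_of_norm_le
    ((hJ.comp_sub_left x).abs.const_mul C) (ae_of_all _ fun y => ?_))
  rw [Real.norm_eq_abs, abs_mul, mul_comm]
  exact mul_le_mul_of_nonneg_right (hC y) (abs_nonneg _)

theorem wconv_sub (hJ : Integrable J) (hv : Continuous v) (hw : Continuous w) {C D : ℝ}
    (hC : ∀ y, |v y * ρ y| ≤ C) (hD : ∀ y, |w y * ρ y| ≤ D) (x : EuclideanSpace ℝ (Fin N)) :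
    wconv ρ J (fun y => v y - w y) x = wconv ρ J v x - wconv ρ J w x := by
  rw [wconv_eq, wconv_eq, wconv_eq,
    ← integral_sub (integrable_sub_mul hJ hv hC x) (integrable_sub_mul hJ hw hD x)]
  congr 1 with y
  ring

theorem wconv_sub_kernel {φ : EuclideanSpace ℝ (Fin N) → ℝ} (hJ : Integrable J)
    (hφ : Integrable φ) (hv : Continuous v) {C : ℝ}
    (hC : ∀ y, |v y * ρ y| ≤ C) (x : EuclideanSpace ℝ (Fin N)) :
    wconv ρ (fun z => J z - φ z) v x = wconv ρ J v x - wconv ρ φ v x := by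
  rw [wconv_eq, wconv_eq, wconv_eq,
    ← integral_sub (integrable_sub_mul hJ hv hC x) (integrable_sub_mul hφ hv hC x)]
  congr 1 with y
  ring

theorem continuous_wconv (hJ : Integrable J) (hv : Continuous v) {C : ℝ}
    (hC : ∀ y, |v y * ρ y| ≤ C) : Continuous (wconv ρ J v) := by
  -- The substitution moves `x` from `J`, which is only integrable, into the continuous bounded
  -- factor.
  have heq : wconv ρ J v = fun x => ∫ z, J z * (v (x - z) * ρ (x - z)) := by
    ext x
    rw [wconv_eq, ← integral_sub_left_eq_self _ volume x]
    simp
  rw [heq]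
  have hρ := ρ.continuous_toFun
  refine continuous_of_dominated (bound := fun z => |J z| * C) (fun x => ?_) (fun x => ?_)
    (hJ.abs.mul_const C) (ae_of_all _ fun z => by fun_prop)
  · exact hJ.aestronglyMeasurable.mul (by fun_prop : Continuous _).aestronglyMeasurable
  · refine ae_of_all _ fun z => ?_
    rw [Real.norm_eq_abs, abs_mul]
    exact mul_le_mul_of_nonneg_left (hC _) (abs_nonneg _)

theorem abs_mul_weight_le {M R : ℝ} (hM : ∀ y, |v y| ≤ M) (hR : ∀ y, ρ y ≤ R)
    (y : EuclideanSpace ℝ (Fin N)) : |v y * ρ y| ≤ M * R := by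
  rw [abs_mul, abs_of_pos (ρ.pos y)]
  exact mul_le_mul (hM y) (hR y) (ρ.pos y).le ((abs_nonneg _).trans (hM y))

/-- A kernel in `L¹` can be replaced by a compactly supported continuous one, up to a uniformly
small error in the convolutions with bounded functions. -/
theorem exists_hasCompactSupport_wconv_sub_le (ρ : Weight N) (hJ : Integrable J) (M : ℝ) {ε : ℝ}
    (hε : 0 < ε) : ∃ φ : EuclideanSpace ℝ (Fin N) → ℝ, HasCompactSupport φ ∧ Continuous φ ∧
      ∀ v : EuclideanSpace ℝ (Fin N) → ℝ, Continuous v → (∀ y, |v y| ≤ M) →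
        ∀ x, |wconv ρ J v x - wconv ρ φ v x| ≤ ε := by
  obtain ⟨R, hR, hρ⟩ := ρ.exists_pos_bound
  -- `|M| + 1` keeps the denominator positive whatever `M` is.
  obtain ⟨φ, hφs, hφ, hφc, hφi⟩ := hJ.exists_hasCompactSupport_integral_sub_le
    (show 0 < ε / ((|M| + 1) * R) by positivity)
  refine ⟨φ, hφs, hφc, fun v hv hM x => ?_⟩
  have hM' : ∀ y, |v y| ≤ |M| + 1 := fun y => by linarith [hM y, le_abs_self M]
  rw [← wconv_sub_kernel hJ hφi hv (abs_mul_weight_le hM' hρ)]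
  refine (abs_wconv_le (hJ.sub hφi) (abs_mul_weight_le hM' hρ) x).trans ?_
  have hpos : 0 < (|M| + 1) * R := by positivity
  calc (|M| + 1) * R * ∫ z, |J z - φ z| ≤ (|M| + 1) * R * (ε / ((|M| + 1) * R)) := by
        gcongr
        exact hφ
    _ = ε := mul_div_cancel₀ _ hpos.ne'

theorem abs_wconv_le_integral {φ : EuclideanSpace ℝ (Fin N) → ℝ}
    (hφ : Integrable (fun y => |φ y| * ρ y)) {M : ℝ} (hM : ∀ y, |v y| ≤ M) :
    |∫ y, φ y * (v y * ρ y)| ≤ M * ∫ y, |φ y| * ρ y := by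
  rw [← integral_const_mul]
  refine (Real.norm_eq_abs _).symm.trans_le
    (norm_integral_le_of_norm_le (hφ.const_mul M) (ae_of_all _ fun y => ?_))
  rw [Real.norm_eq_abs, abs_mul, abs_mul, abs_of_pos (ρ.pos y)]
  have := mul_le_mul_of_nonneg_right (hM y) (mul_nonneg (abs_nonneg (φ y)) (ρ.pos y).le)
  linarith

/-- Convolutions of an `L¹` kernel with uniformly bounded functions are equicontinuous. -/
theorem eventually_abs_wconv_sub_lt (ρ : Weight N) (hJ : Integrable J) (M : ℝ)
    (x : EuclideanSpace ℝ (Fin N)) {ε : ℝ} (hε : 0 < ε) : ∀ᶠ x' in 𝓝 x,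
      ∀ v : EuclideanSpace ℝ (Fin N) → ℝ, Continuous v → (∀ y, |v y| ≤ M) →
        |wconv ρ J v x' - wconv ρ J v x| < ε := by
  obtain ⟨R, hR, hρ⟩ := ρ.exists_pos_bound
  obtain ⟨φ, hφs, hφc, hφ⟩ := exists_hasCompactSupport_wconv_sub_le ρ hJ M
    (show 0 < ε / 3 by positivity)
  have hφi : Integrable φ := hφc.integrable_of_hasCompactSupport hφs
  obtain ⟨S, hS⟩ := hφs.exists_bound_of_continuous hφc
  have hρc := ρ.continuous_toFun
  have hbd : ∀ x' y, ‖|φ (x' - y) - φ (x - y)| * ρ y‖ ≤ 2 * S * ρ y := by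
    intro x' y
    rw [Real.norm_eq_abs, abs_mul, abs_abs, abs_of_pos (ρ.pos y)]
    refine mul_le_mul_of_nonneg_right ?_ (ρ.pos y).le
    have h1 := hS (x' - y)
    have h2 := hS (x - y)
    rw [Real.norm_eq_abs] at h1 h2
    linarith [abs_sub (φ (x' - y)) (φ (x - y))]
  -- This integral bounds the increment of the convolution with `φ` for all admissible `v` at once;
  -- it is continuous in `x'` and vanishes at `x`.
  have hcont : Continuous (fun x' => M * ∫ y, |φ (x' - y) - φ (x - y)| * ρ y) := by
    refine (continuous_of_dominated (bound := fun y => 2 * S * ρ y)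
      (fun x' => (by fun_prop : Continuous _).aestronglyMeasurable)
      (fun x' => ae_of_all _ (hbd x')) (ρ.integrable.const_mul _)
      (ae_of_all _ fun y => by fun_prop)).const_mul M
  have hlim := hcont.tendsto x
  simp only [sub_self, abs_zero, zero_mul, integral_zero, mul_zero] at hlim
  filter_upwards [hlim.eventually (gt_mem_nhds (show 0 < ε / 3 by positivity))] with x' hx' v hv hM
  have h1 := hφ v hv hM x'
  have h2 := hφ v hv hM x
  have hint : Integrable (fun y => |φ (x' - y) - φ (x - y)| * ρ y) :=
    (ρ.integrable.const_mul (2 * S)).mono' (by fun_prop : Continuous _).aestronglyMeasurable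
      (ae_of_all _ (hbd x'))
  have h3 : |wconv ρ φ v x' - wconv ρ φ v x| < ε / 3 := by
    refine lt_of_le_of_lt ?_ hx'
    rw [wconv_eq, wconv_eq, ← integral_sub
      (integrable_sub_mul hφi hv (abs_mul_weight_le hM hρ) x')
      (integrable_sub_mul hφi hv (abs_mul_weight_le hM hρ) x)]
    simp only [← sub_mul]
    exact abs_wconv_le_integral hint hM
  rw [abs_le] at h1 h2
  rw [abs_lt] at h3 ⊢
  constructor <;> linarith

/-- Convolutions with uniformly bounded functions vanish uniformly at infinity. -/
theorem exists_abs_wconv_le_of_norm_gt (ρ : Weight N) (hJ : Integrable J) (M : ℝ) {ε : ℝ}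
    (hε : 0 < ε) : ∃ r : ℝ, ∀ v : EuclideanSpace ℝ (Fin N) → ℝ, Continuous v →
      (∀ y, |v y| ≤ M) → ∀ x, r < ‖x‖ → |wconv ρ J v x| ≤ ε := by
  obtain ⟨φ, hφs, hφc, hφ⟩ := exists_hasCompactSupport_wconv_sub_le ρ hJ M
    (show 0 < ε / 2 by positivity)
  obtain ⟨S, hS⟩ := hφs.exists_bound_of_continuous hφc
  have hρc := ρ.continuous_toFun
  have hbd : ∀ x y, ‖|φ (x - y)| * ρ y‖ ≤ S * ρ y := by
    intro x y
    rw [Real.norm_eq_abs, abs_mul, abs_abs, abs_of_pos (ρ.pos y)]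
    exact mul_le_mul_of_nonneg_right (hS (x - y)) (ρ.pos y).le
  -- Dominated convergence along a filter requires it to be countably generated.
  have hgen : (cocompact (EuclideanSpace ℝ (Fin N))).IsCountablyGenerated := by
    rw [← Metric.cobounded_eq_cocompact, ← comap_norm_atTop]
    infer_instance
  have hlim : Tendsto (fun x => M * ∫ y, |φ (x - y)| * ρ y)
      (cocompact (EuclideanSpace ℝ (Fin N))) (𝓝 (M * ∫ y : EuclideanSpace ℝ (Fin N), 0)) := by
    refine (tendsto_integral_filter_of_dominated_convergence (fun y => S * ρ y)
      (Eventually.of_forall fun x => (by fun_prop : Continuous _).aestronglyMeasurable)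
      (Eventually.of_forall fun x => ae_of_all _ (hbd x)) (ρ.integrable.const_mul _)
      (ae_of_all _ fun y => ?_)).const_mul M
    have h1 := (hφs.is_zero_at_infty.comp
      (Homeomorph.subRight y).isClosedEmbedding.tendsto_cocompact).abs.mul_const (ρ y)
    simpa using h1
  simp only [integral_zero, mul_zero] at hlim
  have hev := hlim.eventually (gt_mem_nhds (show 0 < ε / 2 by positivity))
  rw [← Metric.cobounded_eq_cocompact, hasBasis_cobounded_norm.eventually_iff] at hev
  obtain ⟨r, -, hr⟩ := hev
  refine ⟨r, fun v hv hM x hx => ?_⟩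
  have hint : Integrable (fun y => |φ (x - y)| * ρ y) :=
    (ρ.integrable.const_mul S).mono' (by fun_prop : Continuous _).aestronglyMeasurable
      (ae_of_all _ (hbd x))
  have h1 := hφ v hv hM x
  have h2 : |wconv ρ φ v x| < ε / 2 := by
    refine lt_of_le_of_lt ?_ (hr hx.le)
    rw [wconv_eq]
    exact abs_wconv_le_integral hint hM
  rw [abs_le] at h1 ⊢
  rw [abs_lt] at h2
  constructor <;> linarith

/-- The form `∫ v (J *_ρ w) ρ` is symmetric when `J` is even. -/
theorem integral_mul_wconv_comm (hJ : Integrable J) (hJe : ∀ x, J (-x) = J x)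
    (hv : Continuous v) (hw : Continuous w) {C D : ℝ}
    (hC : ∀ y, |v y| ≤ C) (hD : ∀ y, |w y| ≤ D) :
    ∫ x, v x * wconv ρ J w x * ρ x = ∫ x, w x * wconv ρ J v x * ρ x := by
  obtain ⟨R, hR, hρ⟩ := ρ.exists_pos_bound
  have hρc := ρ.continuous_toFun
  have hvi : Integrable (fun x => v x * ρ x) :=
    ρ.integrable.bdd_mul hv.aestronglyMeasurable (ae_of_all _ hC)
  have hwi : Integrable (fun x => w x * ρ x) :=
    ρ.integrable.bdd_mul hw.aestronglyMeasurable (ae_of_all _ hD)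
  -- For Fubini: the convolution integrand of `w ρ` and `J` is integrable on the product, and `v ρ`
  -- is bounded.
  have hint : Integrable (Function.uncurry fun x y => (v x * ρ x) * (J (x - y) * (w y * ρ y)))
      (volume.prod volume) := by
    have h1 := (hwi.convolution_integrand (ContinuousLinearMap.mul ℝ ℝ) hJ (μ := volume)
      (ν := volume))
    have h2 := h1.bdd_mul (f := fun p : EuclideanSpace ℝ (Fin N) × EuclideanSpace ℝ (Fin N) =>
      v p.1 * ρ p.1) (c := C * R) (by fun_prop : Continuous _).aestronglyMeasurable
      (ae_of_all _ fun p => abs_mul_weight_le hC hρ p.1)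
    refine h2.congr (ae_of_all _ fun p => ?_)
    simp only [Function.uncurry, ContinuousLinearMap.mul_apply']
    ring
  calc ∫ x, v x * wconv ρ J w x * ρ x
      = ∫ x, ∫ y, (v x * ρ x) * (J (x - y) * (w y * ρ y)) := by
        congr 1 with x
        rw [wconv_eq, integral_const_mul]
        ring
    _ = ∫ y, ∫ x, (v x * ρ x) * (J (x - y) * (w y * ρ y)) := integral_integral_swap hint
    _ = ∫ x, w x * wconv ρ J v x * ρ x := by
        congr 1 with y
        rw [wconv_eq, mul_right_comm, ← integral_const_mul]
        congr 1 with x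
        rw [← hJe (y - x), neg_sub]
        ring

end Convolution

/-- The standing assumptions on the connectivity `J`, the stimulus `h` and the firing rate `f`. -/
structure IsAdmissible {N : ℕ} (J h : EuclideanSpace ℝ (Fin N) → ℝ) (f : ℝ → ℝ) : Prop where
  integrable_kernel : Integrable J
  kernel_neg : ∀ x, J (-x) = J x
  continuous_stimulus : Continuous h
  bounded_stimulus : ∃ C, ∀ x, |h x| ≤ C
  lipschitz_rate : ∃ k, LipschitzWith k f
  bounded_rate : ∃ M, ∀ s, |f s| ≤ M
  strictMono_rate : StrictMono f
  zero_mem_closure : 0 ∈ closure (Set.range f)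
  integrableOn_invFun : IntegrableOn (Function.invFun f) (Set.range f)

/-! ### The primitive of `f⁻¹`. -/

section Primitive

variable {f : ℝ → ℝ}

theorem ordConnected_range_of_continuous (hc : Continuous f) : (Set.range f).OrdConnected :=
  (isPreconnected_range hc).ordConnected

/-- Outside the range `Function.invFun f` has a meaningless default value. The range is an interval
with `0` in its closure, so only the point `0` itself can be missing between `0` and `f s`. -/
theorem ae_mem_range_of_mem_uIoc (hc : Continuous f) (h0 : 0 ∈ closure (Set.range f)) (s : ℝ) :
    ∀ᵐ r, r ∈ Set.uIoc 0 (f s) → r ∈ Set.range f := by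
  have hord := ordConnected_range_of_continuous hc
  filter_upwards [compl_mem_ae_iff.2 (measure_singleton (0 : ℝ))] with r hr0 hr
  have hr0 : r ≠ 0 := hr0
  rcases le_total 0 (f s) with h | h
  · rw [Set.uIoc_of_le h] at hr
    obtain ⟨q, hq, hqr⟩ := mem_closure_iff.1 h0 (Set.Iio r) isOpen_Iio hr.1
    exact hord.out hqr ⟨s, rfl⟩ ⟨le_of_lt hq, hr.2⟩
  · rw [Set.uIoc_of_ge h] at hr
    obtain ⟨q, hq, hqr⟩ := mem_closure_iff.1 h0 (Set.Ioi r) isOpen_Ioi (hr.2.lt_of_ne hr0)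
    exact hord.out ⟨s, rfl⟩ hqr ⟨hr.1.le, le_of_lt hq⟩

theorem integrable_indicator_invFun (hc : Continuous f)
    (hi : IntegrableOn (Function.invFun f) (Set.range f)) :
    Integrable ((Set.range f).indicator (Function.invFun f)) :=
  hi.integrable_indicator (ordConnected_range_of_continuous hc).measurableSet

theorem intervalIntegrable_invFun (hc : Continuous f) (h0 : 0 ∈ closure (Set.range f))
    (hi : IntegrableOn (Function.invFun f) (Set.range f)) (s : ℝ) :
    IntervalIntegrable (Function.invFun f) volume 0 (f s) := by
  refine ((integrable_indicator_invFun hc hi).intervalIntegrable (a := 0) (b := f s)).congr_ae ?_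
  rw [Filter.EventuallyEq, ae_restrict_iff' measurableSet_uIoc]
  filter_upwards [ae_mem_range_of_mem_uIoc hc h0 s] with r hr hrs
  exact Set.indicator_of_mem (hr hrs) _

theorem integral_invFun_eq_indicator (hc : Continuous f) (h0 : 0 ∈ closure (Set.range f)) (s : ℝ) :
    ∫ r in (0 : ℝ)..f s, Function.invFun f r =
      ∫ r in (0 : ℝ)..f s, (Set.range f).indicator (Function.invFun f) r := by
  refine intervalIntegral.integral_congr_ae ?_
  filter_upwards [ae_mem_range_of_mem_uIoc hc h0 s] with r hr hrs
  exact (Set.indicator_of_mem (hr hrs) _).symm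

theorem continuous_integral_invFun (hc : Continuous f) (h0 : 0 ∈ closure (Set.range f))
    (hi : IntegrableOn (Function.invFun f) (Set.range f)) :
    Continuous (fun s => ∫ r in (0 : ℝ)..f s, Function.invFun f r) := by
  simp only [integral_invFun_eq_indicator hc h0]
  exact (intervalIntegral.continuous_primitive
    (fun _ _ => (integrable_indicator_invFun hc hi).intervalIntegrable) 0).comp hc

theorem exists_abs_integral_invFun_le (hc : Continuous f) (h0 : 0 ∈ closure (Set.range f))
    (hi : IntegrableOn (Function.invFun f) (Set.range f)) :
    ∃ C, ∀ s, |∫ r in (0 : ℝ)..f s, Function.invFun f r| ≤ C := by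
  have hg := integrable_indicator_invFun hc hi
  refine ⟨∫ r, |(Set.range f).indicator (Function.invFun f) r|, fun s => ?_⟩
  rw [integral_invFun_eq_indicator hc h0, ← Real.norm_eq_abs]
  exact (intervalIntegral.norm_integral_le_integral_norm_uIoc).trans
    (setIntegral_le_integral hg.norm (ae_of_all _ fun _ => norm_nonneg _))

/-- The convexity inequality for the primitive of `f⁻¹`. -/
theorem integral_invFun_sub_le (hm : StrictMono f) (hc : Continuous f)
    (h0 : 0 ∈ closure (Set.range f)) (hi : IntegrableOn (Function.invFun f) (Set.range f))
    (s t : ℝ) : (∫ r in (0 : ℝ)..f s, Function.invFun f r) -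
      (∫ r in (0 : ℝ)..f t, Function.invFun f r) ≤ s * (f s - f t) := by
  have hs := intervalIntegrable_invFun hc h0 hi s
  have ht := intervalIntegrable_invFun hc h0 hi t
  have hts : IntervalIntegrable (Function.invFun f) volume (f t) (f s) := ht.symm.trans hs
  have hval : ∀ q, Function.invFun f (f q) = q := Function.leftInverse_invFun hm.injective
  have hord := ordConnected_range_of_continuous hc
  rw [intervalIntegral.integral_interval_sub_left hs ht]
  -- Between `f t` and `f s` the inverse is at most `s` if `t ≤ s`, and at least `s` otherwise: `s`
  -- is a subgradient of the primitive at `f s`.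
  rcases le_total t s with h | h
  · have := intervalIntegral.integral_mono_on (hm.monotone h) hts
      (intervalIntegrable_const (c := s)) fun r hr => by
        obtain ⟨q, rfl⟩ := hord.out ⟨t, rfl⟩ ⟨s, rfl⟩ hr
        rw [hval]
        exact hm.le_iff_le.1 hr.2
    simpa [mul_comm] using this
  · have := intervalIntegral.integral_mono_on (hm.monotone h) (intervalIntegrable_const (c := s))
      hts.symm fun r hr => by
        obtain ⟨q, rfl⟩ := hord.out ⟨s, rfl⟩ ⟨t, rfl⟩ hr
        rw [hval]
        exact hm.le_iff_le.1 hr.1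
    rw [intervalIntegral.integral_symm]
    simp only [intervalIntegral.integral_const, smul_eq_mul] at this
    linarith

end Primitive

/-! ### The input operator, and the energy as a continuous bounded functional. -/

namespace IsAdmissible

variable {N : ℕ} {ρ : Weight N} {J h : EuclideanSpace ℝ (Fin N) → ℝ} {f : ℝ → ℝ}

theorem continuous_rate (H : IsAdmissible J h f) : Continuous f := by
  obtain ⟨k, hk⟩ := H.lipschitz_rate
  exact hk.continuous

theorem continuous_rate_comp (H : IsAdmissible J h f) (u : CRho ρ) :
    Continuous (fun y => f (u y)) :=
  H.continuous_rate.comp u.coe_continuous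

theorem continuous_wconv_rate (H : IsAdmissible J h f) (u : CRho ρ) :
    Continuous (wconv ρ J (fun y => f (u y))) := by
  obtain ⟨M, hM⟩ := H.bounded_rate
  obtain ⟨R, hR, hρ⟩ := ρ.exists_pos_bound
  exact continuous_wconv H.integrable_kernel (H.continuous_rate_comp u)
    (abs_mul_weight_le (fun y => hM (u y)) hρ)

theorem exists_abs_wconv_rate_le (H : IsAdmissible J h f) (ρ : Weight N) :
    ∃ C, ∀ (u : CRho ρ) x, |wconv ρ J (fun y => f (u y)) x| ≤ C := by
  obtain ⟨M, hM⟩ := H.bounded_rate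
  obtain ⟨R, hR, hρ⟩ := ρ.exists_pos_bound
  exact ⟨_, fun u => abs_wconv_le H.integrable_kernel
    (abs_mul_weight_le (fun y => hM (u y)) hρ)⟩

/-- The weight inside the convolution turns the Lipschitz bound of `f` into the norm of `C_ρ`. The
estimate is uniform in `x` without a weight outside, as the pointwise energy estimates need. -/
theorem exists_abs_wconv_rate_sub_le (H : IsAdmissible J h f) (ρ : Weight N) :
    ∃ L, 0 ≤ L ∧ ∀ (u v : CRho ρ) x,
      |wconv ρ J (fun y => f (u y)) x - wconv ρ J (fun y => f (v y)) x| ≤ L * ‖u - v‖ := by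
  obtain ⟨M, hM⟩ := H.bounded_rate
  obtain ⟨R, hR, hρ⟩ := ρ.exists_pos_bound
  obtain ⟨k, hk⟩ := H.lipschitz_rate
  have hJ : 0 ≤ ∫ z, |J z| := integral_nonneg fun _ => abs_nonneg _
  refine ⟨k * ∫ z, |J z|, by positivity, fun u v x => ?_⟩
  rw [← wconv_sub H.integrable_kernel (H.continuous_rate_comp u) (H.continuous_rate_comp v)
    (abs_mul_weight_le (fun y => hM (u y)) hρ) (abs_mul_weight_le (fun y => hM (v y)) hρ)]
  refine (abs_wconv_le H.integrable_kernel (C := k * ‖u - v‖) (fun y => ?_) x).trans_eq (by ring)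
  rw [abs_mul, abs_of_pos (ρ.pos y)]
  calc |f (u y) - f (v y)| * ρ y ≤ k * |u y - v y| * ρ y :=
        mul_le_mul_of_nonneg_right (hk.dist_le_mul _ _) (ρ.pos y).le
    _ = k * (|(u - v) y| * ρ y) := by rw [CRho.sub_apply, mul_assoc]
    _ ≤ k * ‖u - v‖ := by gcongr; exact CRho.abs_mul_le_norm _ _

/-- The synaptic input `J *_ρ (f ∘ u)` as an element of `C_ρ`. -/
def synaptic (H : IsAdmissible J h f) (u : CRho ρ) : CRho ρ :=
  CRho.ofBounded ρ (wconv ρ J (fun y => f (u y))) (H.continuous_wconv_rate u) (by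
    obtain ⟨C, hC⟩ := H.exists_abs_wconv_rate_le ρ
    exact ⟨C, hC u⟩)

/-- The total input `J *_ρ (f ∘ u) + h` as an element of `C_ρ`. -/
def input (H : IsAdmissible J h f) (u : CRho ρ) : CRho ρ :=
  H.synaptic u + CRho.ofBounded ρ h H.continuous_stimulus H.bounded_stimulus

theorem input_apply (H : IsAdmissible J h f) (u : CRho ρ) (x : EuclideanSpace ℝ (Fin N)) :
    H.input u x = wconv ρ J (fun y => f (u y)) x + h x := rfl

theorem exists_lipschitzWith_synaptic (H : IsAdmissible J h f) (ρ : Weight N) :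
    ∃ K, LipschitzWith K (H.synaptic (ρ := ρ)) := by
  obtain ⟨R, hR, hρ⟩ := ρ.exists_pos_bound
  obtain ⟨L, hL0, hL⟩ := H.exists_abs_wconv_rate_sub_le ρ
  refine ⟨⟨L * R, by positivity⟩, LipschitzWith.of_dist_le_mul fun u v => ?_⟩
  rw [dist_eq_norm, dist_eq_norm]
  exact (CRho.norm_le_of_abs_le hρ (hL u v)).trans_eq (mul_right_comm _ _ _)

theorem exists_lipschitzWith_input (H : IsAdmissible J h f) (ρ : Weight N) :
    ∃ K, LipschitzWith K (H.input (ρ := ρ)) := by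
  obtain ⟨K, hK⟩ := H.exists_lipschitzWith_synaptic ρ
  exact ⟨K + 0, hK.add (LipschitzWith.const _)⟩

theorem exists_norm_input_le (H : IsAdmissible J h f) (ρ : Weight N) :
    ∃ M, ∀ u : CRho ρ, ‖H.input u‖ ≤ M := by
  obtain ⟨R, hR, hρ⟩ := ρ.exists_pos_bound
  obtain ⟨C, hC⟩ := H.exists_abs_wconv_rate_le ρ
  exact ⟨C * R + _, fun u => (norm_add_le _ _).trans
    (add_le_add (CRho.norm_le_of_abs_le hρ (hC u)) le_rfl)⟩

/-- The stimulus need not vanish at infinity, so the compactness criterion is applied without it;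
adding `h` is only a translation. -/
theorem totallyBounded_range_synaptic (H : IsAdmissible J h f) (ρ : Weight N) :
    TotallyBounded (Set.range (H.synaptic (ρ := ρ))) := by
  obtain ⟨M, hM⟩ := H.bounded_rate
  obtain ⟨C, hC⟩ := H.exists_abs_wconv_rate_le ρ
  refine CRho.totallyBounded_of_equicontinuous (M := C) ?_ (fun x ε hε => ?_) fun ε hε => ?_
  · rintro _ ⟨u, rfl⟩
    exact hC u
  · filter_upwards [eventually_abs_wconv_sub_lt ρ H.integrable_kernel M x hε] with x' hx'
    rintro _ ⟨u, rfl⟩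
    exact hx' _ (H.continuous_rate_comp u) fun y => hM (u y)
  · obtain ⟨r, hr⟩ := exists_abs_wconv_le_of_norm_gt ρ H.integrable_kernel M hε
    refine ⟨r, ?_⟩
    rintro _ ⟨u, rfl⟩
    exact hr _ (H.continuous_rate_comp u) fun y => hM (u y)

theorem totallyBounded_range_input (H : IsAdmissible J h f) (ρ : Weight N) :
    TotallyBounded (Set.range (H.input (ρ := ρ))) := by
  have h1 := (H.totallyBounded_range_synaptic ρ).image (uniformContinuous_id.add
    (uniformContinuous_const (b := CRho.ofBounded ρ h H.continuous_stimulus H.bounded_stimulus)))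
  rwa [← Set.range_comp] at h1

theorem continuous_energyDensity_apply (H : IsAdmissible J h f) (u : CRho ρ) :
    Continuous (energyDensity J h f u) := by
  have h1 := H.continuous_rate_comp u
  have h2 := H.continuous_wconv_rate u
  have h3 := (continuous_integral_invFun H.continuous_rate H.zero_mem_closure
    H.integrableOn_invFun).comp u.coe_continuous
  have h4 := H.continuous_stimulus
  exact (((continuous_const.mul h1).mul h2).add h3).sub (h4.mul h1)

theorem continuous_energyDensity (H : IsAdmissible J h f) (x : EuclideanSpace ℝ (Fin N)) :
    Continuous (fun u : CRho ρ => energyDensity J h f u x) := by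
  obtain ⟨K, hK⟩ := H.exists_lipschitzWith_synaptic ρ
  have h0 : Continuous (fun u : CRho ρ => u x) := (CRho.eval x).continuous
  have h1 := H.continuous_rate.comp h0
  have h2 : Continuous (fun u : CRho ρ => wconv ρ J (fun y => f (u y)) x) :=
    (CRho.eval x).continuous.comp hK.continuous
  have h3 := (continuous_integral_invFun H.continuous_rate H.zero_mem_closure
    H.integrableOn_invFun).comp h0
  exact (((continuous_const.mul h1).mul h2).add h3).sub (continuous_const.mul h1)

theorem exists_abs_energyDensity_le (H : IsAdmissible J h f) (ρ : Weight N) :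
    ∃ C, ∀ (u : CRho ρ) x, |energyDensity J h f u x| ≤ C := by
  obtain ⟨M, hM⟩ := H.bounded_rate
  obtain ⟨C, hC⟩ := H.exists_abs_wconv_rate_le ρ
  obtain ⟨D, hD⟩ := H.bounded_stimulus
  obtain ⟨P, hP⟩ := exists_abs_integral_invFun_le H.continuous_rate H.zero_mem_closure
    H.integrableOn_invFun
  refine ⟨1 / 2 * M * C + P + D * M, fun u x => ?_⟩
  have hM0 : 0 ≤ M := (abs_nonneg _).trans (hM 0)
  rw [energyDensity]
  refine (abs_sub _ _).trans (add_le_add ((abs_add_le _ _).trans (add_le_add ?_ (hP _))) ?_)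
  · rw [abs_mul, abs_mul]
    have : |-(1 / 2 : ℝ)| = 1 / 2 := by norm_num
    rw [this]
    exact mul_le_mul (by linarith [hM (u x)]) (hC u x) (abs_nonneg _) (by positivity)
  · rw [abs_mul]
    exact mul_le_mul (hD x) (hM _) (abs_nonneg _) ((abs_nonneg _).trans (hD x))

theorem integrable_energyDensity (H : IsAdmissible J h f) (u : CRho ρ) :
    Integrable (fun x => energyDensity J h f u x * ρ x) := by
  obtain ⟨C, hC⟩ := H.exists_abs_energyDensity_le ρ
  exact ρ.integrable.bdd_mul (H.continuous_energyDensity_apply u).aestronglyMeasurable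
    (ae_of_all _ (hC u))

theorem continuous_energy (H : IsAdmissible J h f) :
    Continuous (fun u : CRho ρ => energy J h f u) := by
  obtain ⟨C, hC⟩ := H.exists_abs_energyDensity_le ρ
  refine continuous_of_dominated (bound := fun x => C * ρ x)
    (fun u => (H.integrable_energyDensity u).aestronglyMeasurable)
    (fun u => ae_of_all _ fun x => ?_) (ρ.integrable.const_mul C)
    (ae_of_all _ fun x => (H.continuous_energyDensity x).mul_const _)
  rw [Real.norm_eq_abs, abs_mul, abs_of_pos (ρ.pos x)]
  exact mul_le_mul_of_nonneg_right (hC u x) (ρ.pos x).le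

theorem bddBelow_range_energy (H : IsAdmissible J h f) (ρ : Weight N) :
    BddBelow (Set.range (fun u : CRho ρ => energy J h f u)) := by
  obtain ⟨C, hC⟩ := H.exists_abs_energyDensity_le ρ
  refine ⟨∫ x, -C * ρ x, ?_⟩
  rintro _ ⟨u, rfl⟩
  exact integral_mono (ρ.integrable.const_mul _) (H.integrable_energyDensity u) fun x =>
    mul_le_mul_of_nonneg_right (neg_le_of_abs_le (hC u x)) (ρ.pos x).le

end IsAdmissible

/-! ### Scalar estimates over short time steps. -/

section RealLemmas

/-- A function whose increments over steps of length `δ ≤ 1` are at most `C δ²` is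
nonincreasing. -/
theorem antitoneOn_of_sub_le_sq {φ : ℝ → ℝ} {C : ℝ}
    (hφ : ∀ s t, 0 ≤ s → s < t → t ≤ s + 1 → φ t - φ s ≤ C * (t - s) ^ 2) :
    AntitoneOn φ (Set.Ici 0) := by
  intro s hs t _ hst
  rcases hst.eq_or_lt with rfl | hst
  · exact le_rfl
  have hs : 0 ≤ s := hs
  -- Cutting `[s, t]` into `n` equal steps, each of length at most 1, costs `n * C ((t - s) / n)²`,
  -- which tends to 0.
  have hbound : ∀ᶠ n : ℕ in atTop, φ t - φ s ≤ C * (t - s) ^ 2 / n := by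
    obtain ⟨m, hm⟩ := exists_nat_ge (t - s)
    filter_upwards [eventually_ge_atTop (max m 1)] with n hn
    have hn1 : (1 : ℝ) ≤ n := by exact_mod_cast (le_max_right m 1).trans hn
    have hnm : t - s ≤ n := hm.trans (by exact_mod_cast (le_max_left m 1).trans hn)
    have hn0 : (0 : ℝ) < n := by linarith
    set η := (t - s) / n with hη
    have hη0 : 0 < η := div_pos (by linarith) hn0
    have hη1 : η ≤ 1 := (div_le_one hn0).2 hnm
    have hind : ∀ j : ℕ, φ (s + j * η) - φ s ≤ j * (C * η ^ 2) := by
      intro j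
      induction j with
      | zero => simp
      | succ j ih =>
        have h1 := hφ (s + j * η) (s + (j + 1 : ℕ) * η) (by positivity)
          (by push_cast; linarith) (by push_cast; linarith)
        have h2 : s + (j + 1 : ℕ) * η - (s + j * η) = η := by push_cast; ring
        rw [h2] at h1
        push_cast at h1 ⊢
        linarith
    have h := hind n
    have h1 : s + n * η = t := by rw [hη]; field_simp; ring
    have h2 : n * (C * η ^ 2) = C * (t - s) ^ 2 / n := by rw [hη]; field_simp
    rwa [h1, h2] at h
  have hlim := tendsto_const_div_atTop_nhds_zero_nat (C * (t - s) ^ 2)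
  linarith [ge_of_tendsto hlim hbound]

/-- For `p' = -p + q` with `q` almost constant, the increment of `p` is almost proportional to the
final velocity. -/
theorem abs_increment_sub_le {p q : ℝ → ℝ} (hp : ∀ τ, HasDerivAt p (-p τ + q τ) τ) {s t c : ℝ}
    (hst : s ≤ t) (hq : ∀ τ ∈ Set.Icc s t, |q τ - q t| ≤ c) :
    |(p t - p s) - (Real.exp (t - s) - 1) * (-p t + q t)| ≤ Real.exp (t - s) * c * (t - s) := by
  -- With `q` frozen at its final value, the integrating factor leaves only the oscillation of `q`.
  have hder : ∀ τ, HasDerivAt (fun τ => Real.exp (τ - s) * (p τ - q t))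
      (Real.exp (τ - s) * (q τ - q t)) τ := by
    intro τ
    have h1 := (((hasDerivAt_id τ).sub_const s).exp).mul ((hp τ).sub_const (q t))
    refine h1.congr_deriv ?_
    simp only [id_eq]
    ring
  have h := (convex_Icc s t).norm_image_sub_le_of_norm_hasDerivWithin_le
    (C := Real.exp (t - s) * c) (fun τ _ => (hder τ).hasDerivWithinAt) (fun τ hτ => by
      rw [norm_mul, Real.norm_eq_abs, Real.norm_eq_abs, Real.abs_exp]
      gcongr
      · exact hτ.2
      · exact hq τ hτ) (Set.left_mem_Icc.2 hst) (Set.right_mem_Icc.2 hst)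
  simp only [sub_self, Real.exp_zero, one_mul, Real.norm_eq_abs,
    abs_of_nonneg (sub_nonneg.2 hst)] at h
  convert h using 2
  ring

/-- Here `du` and `da` stand for the increments of `u` and `f(u)`, and `v` for the final velocity.
Since `du` is nearly `(e^δ - 1) v` with `δ ≤ e^δ - 1 ≤ 2δ`, the monotonicity bound `da² ≤ k du da`
passes from `du` to `v`. -/
theorem neg_mul_le_of_increment {k B δ du da v : ℝ} (hk : 0 < k) (hδ : 0 < δ) (hδ1 : δ ≤ 1)
    (hmono : da ^ 2 ≤ k * (du * da))
    (herr : |du - (Real.exp δ - 1) * v| ≤ B * δ ^ 2) :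
    -v * da ≤ -(da ^ 2 / (2 * k * δ)) + B * δ * |da| := by
  set E := Real.exp δ - 1 with hE
  have hE1 : δ ≤ E := by linarith [Real.add_one_le_exp δ]
  have hE2 : E ≤ 2 * δ := by
    have h := Real.abs_exp_sub_one_le (show |δ| ≤ 1 by rwa [abs_of_pos hδ])
    rw [abs_of_pos hδ] at h
    exact (le_abs_self _).trans h
  have hE0 : 0 < E := hδ.trans_le hE1
  have hB : 0 ≤ B := by
    have := (abs_nonneg _).trans herr
    exact nonneg_of_mul_nonneg_left this (by positivity)
  have h1 : -v * da = (-(du * da) + (du - E * v) * da) / E := by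
    field_simp
    ring
  have h2 : (du - E * v) * da ≤ B * δ ^ 2 * |da| :=
    (le_abs_self _).trans ((abs_mul _ _).trans_le
      (mul_le_mul_of_nonneg_right herr (abs_nonneg _)))
  have h3 : da ^ 2 / k ≤ du * da := by rwa [div_le_iff₀' hk]
  have h4 : da ^ 2 / (2 * k * δ) ≤ da ^ 2 / k / E := by
    rw [div_div]
    exact div_le_div_of_nonneg_left (sq_nonneg _) (by positivity) (by nlinarith)
  have h5 : B * δ ^ 2 * |da| / E ≤ B * δ * |da| := by
    rw [div_le_iff₀ hE0]
    have : 0 ≤ B * δ * |da| := by positivity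
    nlinarith
  rw [h1]
  calc (-(du * da) + (du - E * v) * da) / E ≤ (-(da ^ 2 / k) + B * δ ^ 2 * |da|) / E := by
        gcongr
    _ = -(da ^ 2 / k / E) + B * δ ^ 2 * |da| / E := by ring
    _ ≤ _ := by linarith

theorem sq_sub_le_mul_of_lipschitz_of_monotone {f : ℝ → ℝ} {k : NNReal} (hk : LipschitzWith k f)
    (hm : Monotone f) (s t : ℝ) : (f s - f t) ^ 2 ≤ k * ((s - t) * (f s - f t)) := by
  have h := hk.dist_le_mul s t
  rw [Real.dist_eq, Real.dist_eq] at h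
  rcases le_total t s with hst | hst
  · have h1 := hm hst
    rw [abs_of_nonneg (by linarith), abs_of_nonneg (by linarith)] at h
    nlinarith
  · have h1 := hm hst
    rw [abs_of_nonpos (by linarith), abs_of_nonpos (by linarith)] at h
    nlinarith

/-- `a` and `b` are the two halves of the antisymmetric term, which disappears on integration by
symmetry of the convolution form. -/
theorem integral_sub_add_le_of_forall_le {X : Type*} [MeasurableSpace X] {μ : Measure X}
    {e₂ e₁ q r a b : X → ℝ} (he₂ : Integrable e₂ μ) (he₁ : Integrable e₁ μ) (hq : Integrable q μ)
    (hr : Integrable r μ) (ha : Integrable a μ) (hb : Integrable b μ)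
    (hab : ∫ x, a x ∂μ = ∫ x, b x ∂μ)
    (hle : ∀ x, e₂ x - e₁ x ≤ -q x + r x - 1 / 2 * (a x - b x)) :
    ∫ x, e₂ x ∂μ - ∫ x, e₁ x ∂μ + ∫ x, q x ∂μ ≤ ∫ x, r x ∂μ := by
  have h : ∫ x, e₂ x - e₁ x + q x ∂μ ≤ ∫ x, r x - 1 / 2 * (a x - b x) ∂μ :=
    integral_mono ((he₂.sub he₁).add hq) (hr.sub ((ha.sub hb).const_mul (1 / 2)))
      fun x => by linarith [hle x]
  have h₁ : Integrable (fun x => e₂ x - e₁ x) μ := he₂.sub he₁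
  have h₂ : Integrable (fun x => 1 / 2 * (a x - b x)) μ := (ha.sub hb).const_mul (1 / 2)
  rw [integral_add h₁ hq, integral_sub he₂ he₁, integral_sub hr h₂, integral_const_mul,
    integral_sub ha hb, hab,
    sub_self, mul_zero, sub_zero] at h
  exact h

end RealLemmas

/-! ### Dissipation of energy along solutions. -/

namespace IsAdmissible

variable {N : ℕ} {ρ : Weight N} {J h : EuclideanSpace ℝ (Fin N) → ℝ} {f : ℝ → ℝ}

theorem exists_norm_sub_le (H : IsAdmissible J h f) {α : ℝ → CRho ρ}
    (hα : ∀ t, HasDerivAt α (-α t + H.input (α t)) t) :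
    ∃ A, 0 ≤ A ∧ ∀ s t, 0 ≤ s → s ≤ t → ‖α t - α s‖ ≤ A * (t - s) := by
  obtain ⟨M, hM⟩ := H.exists_norm_input_le ρ
  have hM0 : 0 ≤ M := (norm_nonneg _).trans (hM 0)
  refine ⟨‖α 0‖ + M + M, by positivity, fun s t hs hst => ?_⟩
  have hb := (convex_Ici (0 : ℝ)).norm_image_sub_le_of_norm_hasDerivWithin_le
    (C := ‖α 0‖ + M + M) (fun τ _ => (hα τ).hasDerivWithinAt) (fun τ hτ => by
      have h1 := norm_relaxation_le hα hM hτ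
      have h2 : Real.exp (-τ) ≤ 1 := Real.exp_le_one_iff.2 (neg_nonpos.2 hτ)
      have h3 := Real.exp_pos (-τ)
      have h4 := norm_add_le (-α τ) (H.input (α τ))
      rw [norm_neg] at h4
      nlinarith [hM (α τ), norm_nonneg (α 0)]) hs (Set.mem_Ici.2 (hs.trans hst))
  rwa [Real.norm_eq_abs, abs_of_nonneg (sub_nonneg.2 hst)] at hb

/-- The convexity estimate for the increments of the energy density. -/
theorem energyDensity_sub_le (H : IsAdmissible J h f) (u w : CRho ρ)
    (x : EuclideanSpace ℝ (Fin N)) :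
    energyDensity J h f w x - energyDensity J h f u x ≤
      -(-w x + H.input w x) * (f (w x) - f (u x))
      + 1 / 2 * (f (w x) - f (u x)) * (wconv ρ J (fun y => f (w y)) x
          - wconv ρ J (fun y => f (u y)) x)
      - 1 / 2 * (f (u x) * wconv ρ J (fun y => f (w y)) x
          - f (w x) * wconv ρ J (fun y => f (u y)) x) := by
  -- Convexity supplies `w x * (f (w x) - f (u x))`; the rest is algebra, splitting the quadratic
  -- part into its value at the final state, a second-order correction and an antisymmetric
  -- remainder.
  have h1 := integral_invFun_sub_le H.strictMono_rate H.continuous_rate H.zero_mem_closure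
    H.integrableOn_invFun (w x) (u x)
  rw [energyDensity, energyDensity, input_apply]
  linarith

theorem integrable_of_bounded (ρ : Weight N) {g : EuclideanSpace ℝ (Fin N) → ℝ} (hg : Continuous g)
    {C : ℝ} (hC : ∀ x, |g x| ≤ C) : Integrable (fun x => g x * ρ x) :=
  ρ.integrable.bdd_mul hg.aestronglyMeasurable (ae_of_all _ hC)

theorem integrable_rate_mul_wconv (H : IsAdmissible J h f) (u w : CRho ρ) :
    Integrable (fun x => f (u x) * wconv ρ J (fun y => f (w y)) x * ρ x) := by
  obtain ⟨M, hM⟩ := H.bounded_rate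
  obtain ⟨C, hC⟩ := H.exists_abs_wconv_rate_le ρ
  refine integrable_of_bounded ρ ((H.continuous_rate_comp u).mul (H.continuous_wconv_rate w))
    (C := M * C) fun x => ?_
  rw [abs_mul]
  exact mul_le_mul (hM _) (hC w x) (abs_nonneg _) ((abs_nonneg _).trans (hM 0))

theorem abs_rate_sub_le {M : ℝ} (hM : ∀ s, |f s| ≤ M) (s t : ℝ) : |f s - f t| ≤ 2 * M := by
  linarith [abs_sub (f s) (f t), hM s, hM t]

theorem integrable_rate_sub_sq (H : IsAdmissible J h f) (u w : CRho ρ) :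
    Integrable (fun x => (f (w x) - f (u x)) ^ 2 * ρ x) := by
  obtain ⟨M, hM⟩ := H.bounded_rate
  refine integrable_of_bounded ρ (((H.continuous_rate_comp w).sub (H.continuous_rate_comp u)).pow 2)
    (C := (2 * M) ^ 2) fun x => ?_
  rw [abs_pow]
  exact pow_le_pow_left₀ (abs_nonneg _) (abs_rate_sub_le hM _ _) 2

theorem integrable_abs_rate_sub (H : IsAdmissible J h f) (u w : CRho ρ) :
    Integrable (fun x => |f (w x) - f (u x)| * ρ x) := by
  obtain ⟨M, hM⟩ := H.bounded_rate
  refine integrable_of_bounded ρ ((H.continuous_rate_comp w).sub (H.continuous_rate_comp u)).abs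
    (C := 2 * M) fun x => ?_
  rw [abs_abs]
  exact abs_rate_sub_le hM _ _

/-- A pointwise dissipation estimate, up to an antisymmetric term. -/
theorem exists_energyDensity_step_le (H : IsAdmissible J h f) {α : ℝ → CRho ρ}
    (hα : ∀ t, HasDerivAt α (-α t + H.input (α t)) t) :
    ∃ c C : ℝ, 0 < c ∧ ∀ s t, 0 ≤ s → s < t → t ≤ s + 1 → ∀ x,
      energyDensity J h f (α t) x - energyDensity J h f (α s) x ≤
        -(c / (t - s) * (f (α t x) - f (α s x)) ^ 2) + C * (t - s) ^ 3
        - 1 / 2 * (f (α s x) * wconv ρ J (fun y => f (α t y)) x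
          - f (α t x) * wconv ρ J (fun y => f (α s y)) x) := by
  obtain ⟨A, hA0, hA⟩ := H.exists_norm_sub_le hα
  obtain ⟨L, hL0, hL⟩ := H.exists_abs_wconv_rate_sub_le ρ
  obtain ⟨k₀, hk₀⟩ := H.lipschitz_rate
  set k : NNReal := k₀ + 1 with hkdef
  have hk : LipschitzWith k f := hk₀.weaken le_self_add
  have hkpos : (0 : ℝ) < k := by
    rw [hkdef]
    positivity
  -- Two errors of size `δ |da|`: `3 L A` from freezing the input, with `e^δ ≤ 3`, and `L A` from
  -- the quadratic correction. Young's inequality absorbs them in half of the dissipation, so `1 /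
  -- (2k)` becomes `1 / (4k)` and `k D² δ³` is left over.
  set D := 3 * (L * A) + L * A with hD
  have hD0 : 0 ≤ D := by positivity
  refine ⟨1 / (4 * k), k * D ^ 2, by positivity, fun s t hs hst ht x => ?_⟩
  set δ := t - s with hδ
  have hδ0 : 0 < δ := sub_pos.2 hst
  have hδ1 : δ ≤ 1 := by linarith
  set da := f (α t x) - f (α s x) with hda
  have hG : ∀ τ ∈ Set.Icc s t, |wconv ρ J (fun y => f (α τ y)) x
      - wconv ρ J (fun y => f (α t y)) x| ≤ L * A * δ := by
    intro τ hτ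
    refine (hL _ _ x).trans ?_
    rw [mul_assoc]
    gcongr
    rw [norm_sub_rev]
    exact (hA τ t (hs.trans hτ.1) hτ.2).trans (by gcongr; linarith [hτ.1])
  have hp : ∀ τ, HasDerivAt (fun τ => α τ x) (-α τ x + H.input (α τ) x) τ := fun τ =>
    (CRho.eval x).hasFDerivAt.comp_hasDerivAt τ (hα τ)
  have hexp : Real.exp δ ≤ 3 := by
    have := Real.exp_le_exp.2 hδ1
    linarith [Real.exp_one_lt_three]
  have herr : |(α t x - α s x) - (Real.exp δ - 1) * (-α t x + H.input (α t) x)|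
      ≤ 3 * (L * A) * δ ^ 2 := by
    have h1 := abs_increment_sub_le hp hst.le (c := L * A * δ) fun τ hτ => by
      rw [input_apply, input_apply, add_sub_add_right_eq_sub]
      exact hG τ hτ
    refine h1.trans ?_
    calc Real.exp δ * (L * A * δ) * δ ≤ 3 * (L * A * δ) * δ := by gcongr
      _ = 3 * (L * A) * δ ^ 2 := by ring
  have h1 := neg_mul_le_of_increment hkpos hδ0 hδ1
    (sq_sub_le_mul_of_lipschitz_of_monotone hk H.strictMono_rate.monotone (α t x) (α s x)) herr
  rw [← hda] at h1
  have h2 := H.energyDensity_sub_le (α s) (α t) x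
  rw [← hda] at h2
  have h3 : 1 / 2 * da * (wconv ρ J (fun y => f (α t y)) x - wconv ρ J (fun y => f (α s y)) x)
      ≤ L * A * δ * |da| := by
    have h4 := hG s (Set.left_mem_Icc.2 hst.le)
    rw [abs_sub_comm] at h4
    refine (le_abs_self _).trans ?_
    rw [abs_mul, abs_mul]
    have h5 := mul_le_mul_of_nonneg_left h4 (abs_nonneg da)
    have h6 : |(1 / 2 : ℝ)| = 1 / 2 := by norm_num
    rw [h6]
    have h7 : 0 ≤ |da| * (L * A * δ) := by positivity
    linarith
  have h4 : D * δ * |da| ≤ da ^ 2 / (4 * k * δ) + k * D ^ 2 * δ ^ 3 := by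
    have h5 : da ^ 2 / (4 * k * δ) + k * D ^ 2 * δ ^ 3 - D * δ * |da|
        = (|da| - 2 * k * D * δ ^ 2) ^ 2 / (4 * k * δ) := by
      rw [← sq_abs da]
      field_simp
      ring
    have h6 : 0 ≤ (|da| - 2 * k * D * δ ^ 2) ^ 2 / (4 * k * δ) := by positivity
    linarith
  have h5 : da ^ 2 / (2 * k * δ) = 1 / (4 * k) / δ * da ^ 2 + da ^ 2 / (4 * k * δ) := by
    field_simp
    ring
  have h6 : D * δ * |da| = 3 * (L * A) * δ * |da| + L * A * δ * |da| := by rw [hD]; ring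
  linarith

/-- The dissipation estimate for the energy over a short time step. -/
theorem exists_energy_step_le (H : IsAdmissible J h f) {α : ℝ → CRho ρ}
    (hα : ∀ t, HasDerivAt α (-α t + H.input (α t)) t) :
    ∃ c C : ℝ, 0 < c ∧ 0 ≤ C ∧ ∀ s t, 0 ≤ s → s < t → t ≤ s + 1 →
      energy J h f (α t) - energy J h f (α s)
        + c / (t - s) * ∫ x, (f (α t x) - f (α s x)) ^ 2 * ρ x ≤ C * (t - s) ^ 3 := by
  obtain ⟨c, C, hc, hstep⟩ := H.exists_energyDensity_step_le hα
  obtain ⟨M, hM⟩ := H.bounded_rate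
  have hρ0 : 0 ≤ ∫ x, ρ x := integral_nonneg fun x => (ρ.pos x).le
  refine ⟨c, |C| * ∫ x, ρ x, hc, by positivity, fun s t hs hst ht => ?_⟩
  have hsym := integral_mul_wconv_comm (ρ := ρ) H.integrable_kernel H.kernel_neg
    (H.continuous_rate_comp (α s)) (H.continuous_rate_comp (α t))
    (fun y => hM (α s y)) (fun y => hM (α t y))
  have i1 := H.integrable_energyDensity (α t)
  have i2 := H.integrable_energyDensity (α s)
  have i3 := (H.integrable_rate_sub_sq (α s) (α t)).const_mul (c / (t - s))
  have i4 := ρ.integrable.const_mul (C * (t - s) ^ 3)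
  have i5 := H.integrable_rate_mul_wconv (α s) (α t)
  have i6 := H.integrable_rate_mul_wconv (α t) (α s)
  have hle := integral_sub_add_le_of_forall_le i1 i2 i3 i4 i5 i6 hsym fun x => by
    have h1 := mul_le_mul_of_nonneg_right (hstep s t hs hst ht x) (ρ.pos x).le
    linarith
  rw [integral_const_mul, integral_const_mul] at hle
  have hδ : 0 ≤ (t - s) ^ 3 := pow_nonneg (sub_nonneg.2 hst.le) 3
  have hC : C * (t - s) ^ 3 * ∫ x, ρ x ≤ |C| * (∫ x, ρ x) * (t - s) ^ 3 := by
    have := mul_le_mul_of_nonneg_right (le_abs_self C) (mul_nonneg hδ hρ0)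
    linarith
  exact hle.trans hC

theorem antitoneOn_energy (H : IsAdmissible J h f) {α : ℝ → CRho ρ}
    (hα : ∀ t, HasDerivAt α (-α t + H.input (α t)) t) :
    AntitoneOn (fun t => energy J h f (α t)) (Set.Ici 0) := by
  obtain ⟨c, C, hc, hC, hstep⟩ := H.exists_energy_step_le hα
  refine antitoneOn_of_sub_le_sq (C := C) fun s t hs hst ht => ?_
  have h1 := hstep s t hs hst ht
  have hδ : 0 < t - s := sub_pos.2 hst
  have h2 : 0 ≤ c / (t - s) * ∫ x, (f (α t x) - f (α s x)) ^ 2 * ρ x :=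
    mul_nonneg (by positivity) (integral_nonneg fun x => mul_nonneg (sq_nonneg _) (ρ.pos x).le)
  have h3 : C * (t - s) ^ 3 ≤ C * (t - s) ^ 2 :=
    mul_le_mul_of_nonneg_left (pow_le_pow_of_le_one hδ.le (by linarith) (by norm_num)) hC
  linarith

/-- A solution with constant energy is constant. -/
theorem eq_of_energy_eq (H : IsAdmissible J h f) {α : ℝ → CRho ρ}
    (hα : ∀ t, HasDerivAt α (-α t + H.input (α t)) t)
    (hF : ∀ t, 0 ≤ t → energy J h f (α t) = energy J h f (α 0)) {t : ℝ} (ht : 0 ≤ t) :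
    α t = α 0 := by
  obtain ⟨c, C, hc, hC, hstep⟩ := H.exists_energy_step_le hα
  have hsmall : ∀ s t, 0 ≤ s → s < t → t ≤ s + 1 →
      ∫ x, |f (α t x) - f (α s x)| * ρ x ≤ (C / c + ∫ x, ρ x) / 2 * (t - s) ^ 2 := by
    intro s t hs hst ht
    have hδ : 0 < t - s := sub_pos.2 hst
    set δ := t - s
    have h1 := hstep s t hs hst ht
    rw [hF t (hs.trans hst.le), hF s hs, sub_self, zero_add, div_mul_eq_mul_div,
      div_le_iff₀ hδ] at h1
    have i2 := H.integrable_rate_sub_sq (α s) (α t)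
    have h2 : ∫ x, (f (α t x) - f (α s x)) ^ 2 * ρ x ≤ C / c * δ ^ 4 := by
      rw [div_mul_eq_mul_div, le_div_iff₀ hc]
      linarith
    -- Young's inequality with weight `δ²` converts the bound of order `δ⁴` for the squares into one
    -- of order `δ²` for the absolute values.
    have h3 := integral_mono (H.integrable_abs_rate_sub (α s) (α t))
      ((i2.const_mul (1 / (2 * δ ^ 2))).add (ρ.integrable.const_mul (δ ^ 2 / 2))) fun x => by
        simp only [Pi.add_apply]
        rw [← mul_assoc, ← add_mul]
        refine mul_le_mul_of_nonneg_right ?_ (ρ.pos x).le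
        set a := f (α t x) - f (α s x)
        have h4 : 1 / (2 * δ ^ 2) * a ^ 2 + δ ^ 2 / 2 - |a| = (|a| - δ ^ 2) ^ 2 / (2 * δ ^ 2) := by
          rw [← sq_abs a]
          field_simp
          ring
        have h5 : 0 ≤ (|a| - δ ^ 2) ^ 2 / (2 * δ ^ 2) := by positivity
        linarith
    simp only [Pi.add_apply] at h3
    rw [integral_add (i2.const_mul _) (ρ.integrable.const_mul _), integral_const_mul,
      integral_const_mul] at h3
    refine h3.trans ?_
    calc 1 / (2 * δ ^ 2) * (∫ x, (f (α t x) - f (α s x)) ^ 2 * ρ x) + δ ^ 2 / 2 * ∫ x, ρ x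
        ≤ 1 / (2 * δ ^ 2) * (C / c * δ ^ 4) + δ ^ 2 / 2 * ∫ x, ρ x := by gcongr
      _ = (C / c + ∫ x, ρ x) / 2 * δ ^ 2 := by
        field_simp
  -- By the triangle inequality the distance of `f ∘ u` from its initial state grows by at most
  -- order `δ²` per step; hence it is nonincreasing, and it starts at 0.
  have hanti := antitoneOn_of_sub_le_sq (φ := fun t => ∫ x, |f (α t x) - f (α 0 x)| * ρ x)
    fun s t hs hst ht => by
      refine le_trans ?_ (hsmall s t hs hst ht)
      rw [← integral_sub (H.integrable_abs_rate_sub _ _) (H.integrable_abs_rate_sub _ _)]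
      refine integral_mono ((H.integrable_abs_rate_sub _ _).sub (H.integrable_abs_rate_sub _ _))
        (H.integrable_abs_rate_sub _ _) fun x => ?_
      beta_reduce
      rw [← sub_mul]
      refine mul_le_mul_of_nonneg_right ?_ (ρ.pos x).le
      linarith [abs_sub_le (f (α t x)) (f (α s x)) (f (α 0 x))]
  have hnonneg : ∀ x, 0 ≤ |f (α t x) - f (α 0 x)| * ρ x := fun x =>
    mul_nonneg (abs_nonneg _) (ρ.pos x).le
  have hzero : ∫ x, |f (α t x) - f (α 0 x)| * ρ x = 0 := by
    refine le_antisymm ?_ (integral_nonneg hnonneg)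
    simpa using hanti Set.self_mem_Ici ht ht
  rw [integral_eq_zero_iff_of_nonneg hnonneg (H.integrable_abs_rate_sub _ _)] at hzero
  have hcont : Continuous (fun x => |f (α t x) - f (α 0 x)| * ρ x) :=
    (((H.continuous_rate_comp (α t)).sub (H.continuous_rate_comp (α 0))).abs).mul
      ρ.continuous_toFun
  have heq := (hcont.ae_eq_iff_eq volume continuous_const).1 hzero
  refine CRho.ext fun x => H.strictMono_rate.injective ?_
  have h1 : |f (α t x) - f (α 0 x)| * ρ x = 0 := congrFun heq x
  simpa [sub_eq_zero, (ρ.pos x).ne'] using h1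

end IsAdmissible

/-! ### A coercive Lyapunov functional. -/

section Lyapunov

theorem eq_of_forall_nonneg_eq {X : Type*} {T : ℝ → X → X} (h0 : ∀ u, T 0 u = u)
    (hadd : ∀ s t u, T (s + t) u = T s (T t u)) {u : X} (hu : ∀ t, 0 ≤ t → T t u = u) (t : ℝ) : T t u = u := by
  rcases le_total 0 t with ht | ht
  · exact hu t ht
  · have h := hadd t (-t) u
    rw [hu (-t) (neg_nonneg.2 ht), add_neg_cancel, h0] at h
    exact h.symm

variable {X : Type*} [NormedAddCommGroup X] {T : ℝ → X → X}

theorem antitoneOn_max_norm_sub {M : ℝ} (hadd : ∀ s t u, T (s + t) u = T s (T t u))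
    (hM : ∀ u t, 0 ≤ t → ‖T t u‖ ≤ Real.exp (-t) * ‖u‖ + (1 - Real.exp (-t)) * M) (u : X) :
    AntitoneOn (fun t => max (‖T t u‖ - M) 0) (Set.Ici 0) := by
  intro s _ t _ hst
  have h1 := hM (T s u) (t - s) (sub_nonneg.2 hst)
  rw [← hadd, sub_add_cancel] at h1
  have h2 : Real.exp (-(t - s)) ≤ 1 := Real.exp_le_one_iff.2 (by linarith)
  have h3 := Real.exp_pos (-(t - s))
  refine max_le ?_ (le_max_right _ _)
  calc ‖T t u‖ - M ≤ Real.exp (-(t - s)) * (‖T s u‖ - M) := by linarith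
    _ ≤ Real.exp (-(t - s)) * max (‖T s u‖ - M) 0 :=
      mul_le_mul_of_nonneg_left (le_max_left _ _) h3.le
    _ ≤ 1 * max (‖T s u‖ - M) 0 := mul_le_mul_of_nonneg_right h2 (le_max_right _ _)
    _ = _ := one_mul _

/-- A Lyapunov functional `F` which detects equilibria on positive orbits becomes coercive after
adding a functional of the norm, if the flow has a globally attracting ball. -/
theorem isLyapunovFunctional_add_max_norm {F : X → ℝ} {M : ℝ} (h0 : ∀ u, T 0 u = u)
    (hadd : ∀ s t u, T (s + t) u = T s (T t u)) (hF : IsLyapunovFunctional T F)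
    (heq : ∀ u, (∀ t, 0 ≤ t → F (T t u) = F u) → ∀ t, 0 ≤ t → T t u = u)
    (hM : ∀ u t, 0 ≤ t → ‖T t u‖ ≤ Real.exp (-t) * ‖u‖ + (1 - Real.exp (-t)) * M) :
    IsLyapunovFunctional T (fun u => F u + max (‖u‖ - M) 0) := by
  have hanti := antitoneOn_max_norm_sub hadd hM
  refine ⟨hF.continuous.add (by fun_prop), ?_, fun u => (hF.nonincreasing u).add (hanti u),
    fun u hu => eq_of_forall_nonneg_eq h0 hadd (heq u fun t ht => ?_)⟩
  · obtain ⟨m, hm⟩ := hF.bddBelow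
    refine ⟨m, ?_⟩
    rintro _ ⟨u, rfl⟩
    exact (hm ⟨u, rfl⟩).trans (le_add_of_nonneg_right (le_max_right _ _))
  -- Both summands are nonincreasing on `[0, ∞)`, so a constant sum makes each constant there. This
  -- says nothing about negative times, which is why `heq` concerns positive orbits only.
  · have h1 := hF.nonincreasing u Set.self_mem_Ici ht ht
    have h2 := hanti u Set.self_mem_Ici ht ht
    have h3 := hu t
    simp only [h0] at h1 h2
    exact le_antisymm h1 (by linarith)

theorem tendsto_add_max_norm_atTop {F : X → ℝ} (hF : BddBelow (Set.range F)) (M : ℝ) :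
    Tendsto (fun u => F u + max (‖u‖ - M) 0) (Bornology.cobounded X) atTop := by
  obtain ⟨m, hm⟩ := hF
  refine tendsto_atTop_mono (f := fun u => m + (‖u‖ - M)) (fun u => ?_) ?_
  · exact add_le_add (hm ⟨u, rfl⟩) (le_max_left _ _)
  · exact tendsto_atTop_add_const_left _ _
      (tendsto_atTop_add_const_right _ (-M) tendsto_norm_cobounded_atTop)

end Lyapunov

/-! ### Assembly of the theorem. -/

namespace IsAdmissible

variable {N : ℕ} {ρ : Weight N} {J h : EuclideanSpace ℝ (Fin N) → ℝ} {f : ℝ → ℝ}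

theorem isSolutionOn_iff (H : IsAdmissible J h f) {u : ℝ → CRho ρ} {I : Set ℝ} :
    IsSolutionOn J h f u I ↔ ∀ t ∈ I, HasDerivWithinAt u (-u t + H.input (u t)) I t := by
  refine forall₂_congr fun t _ => ⟨?_, fun hu => ⟨_, hu, fun x => ?_⟩⟩
  · rintro ⟨v, hv, hvx⟩
    have : v = -u t + H.input (u t) := CRho.ext fun x => by
      rw [hvx, CRho.add_apply, CRho.neg_apply, input_apply, add_assoc]
    rwa [← this]
  · rw [CRho.add_apply, CRho.neg_apply, input_apply, add_assoc]

end IsAdmissible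
end NeuralField

end

theorem mainTheorem4 (N : ℕ) (ρ : NeuralField.Weight N)
    (J h : EuclideanSpace ℝ (Fin N) → ℝ) (f : ℝ → ℝ)
    (hJ_int : Integrable J) (hJ_nonneg : ∀ x, 0 ≤ J x) (hJ_even : ∀ x, J (-x) = J x)
    (hh_cont : Continuous h) (hh_bdd : ∃ C, ∀ x, |h x| ≤ C)
    (hf_lip : ∃ k, LipschitzWith k f) (hf_bdd : ∃ M, ∀ s, |f s| ≤ M)
    (hf_mono : StrictMono f) (hf_diff : Differentiable ℝ f)
    (hf_zero : 0 ∈ closure (Set.range f))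
    (hf_inv : IntegrableOn (Function.invFun f) (Set.range f)) :
    ∃ T : ℝ → NeuralField.CRho ρ → NeuralField.CRho ρ,
      NeuralField.IsGeneratedFlow J h f T ∧
      NeuralField.IsGradient T ∧
      (∀ u : NeuralField.CRho ρ,
        (∀ x, Integrable (fun y => J (x - y) * f (u y) * ρ y)) ∧
        (∀ x, IntervalIntegrable (Function.invFun f) volume 0 (f (u x))) ∧
        Integrable (fun x => NeuralField.energyDensity J h f u x * ρ x)) ∧
      NeuralField.IsLyapunovFunctional T (NeuralField.energy J h f) := by
  have H : NeuralField.IsAdmissible J h f :=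
    ⟨hJ_int, hJ_even, hh_cont, hh_bdd, hf_lip, hf_bdd, hf_mono, hf_zero, hf_inv⟩
  obtain ⟨K, hK⟩ := H.exists_lipschitzWith_input ρ
  obtain ⟨M, hM⟩ := H.exists_norm_input_le ρ
  obtain ⟨T, h0, hT, hadd, huniq, hcont⟩ := NeuralField.exists_relaxation_flow hK hM
  have hconst : ∀ u, (∀ t, 0 ≤ t →
      NeuralField.energy J h f (T t u) = NeuralField.energy J h f u) →
      ∀ t, 0 ≤ t → T t u = u := fun u hu t ht => by
    have := H.eq_of_energy_eq (hT u) (fun s hs => by rw [h0]; exact hu s hs) ht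
    rwa [h0] at this
  have hF : NeuralField.IsLyapunovFunctional T (NeuralField.energy J h f) :=
    ⟨H.continuous_energy, H.bddBelow_range_energy ρ, fun u => H.antitoneOn_energy (hT u),
      fun u hu => NeuralField.eq_of_forall_nonneg_eq h0 hadd (hconst u fun t _ => hu t)⟩
  refine ⟨T, ⟨h0, hadd, fun u => H.isSolutionOn_iff.2 fun t _ => (hT u t).hasDerivWithinAt,
    fun I v hI hI0 hv => huniq I v hI hI0 (H.isSolutionOn_iff.1 hv), hcont⟩,
    ⟨fun u _ => NeuralField.isCompact_closure_relaxation_orbit (hT u)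
      (H.totallyBounded_range_input ρ), _,
      NeuralField.isLyapunovFunctional_add_max_norm (M := M) h0 hadd hF hconst fun u t ht => ?_,
      NeuralField.tendsto_add_max_norm_atTop hF.bddBelow M⟩, fun u => ⟨fun x => ?_, fun x => ?_,
      H.integrable_energyDensity u⟩, hF⟩
  · have := NeuralField.norm_relaxation_le (hT u) hM ht
    rwa [h0] at this
  · obtain ⟨D, hD⟩ := hf_bdd
    obtain ⟨R, hR, hρ⟩ := ρ.exists_pos_bound
    simpa only [mul_assoc] using NeuralField.integrable_sub_mul hJ_int (H.continuous_rate_comp u)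
      (NeuralField.abs_mul_weight_le (fun y => hD (u y)) hρ) x
  · exact NeuralField.intervalIntegrable_invFun H.continuous_rate hf_zero hf_inv (u x)
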